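/- For a group $G$, let $\Gamma_1(G)=G$ and $\Gamma_{j+1}(G)=[\Gamma_j(G),G]$ be its lower central series, let $IA_G\subseteq \operatorname{Aut}(G)$ be the group of automorphisms acting trivially on $G^{ab}$, and for $j\ge 1$ let $$\mathcal A_j(G)=\{\varphi\in \operatorname{Aut}(G) \mid \forall i\ge 1,\ \forall h\in\Gamma_i(G),\ \varphi(h)h^{-1}\in\Gamma_{i+j}(G)\}$$ be the Andreadakis filtration. A subgroup $K$ of $IA_G$ is said to satisfy the Andreadakis equality if the inclusions $$\Gamma_j(K)\subseteq K\cap\Gamma_j(IA_G)\subseteq K\cap\mathcal A_j(G)$$ are equalities for all $j\ge 1$. Let $F_n$ be the free group on an ordered basis $(x_1,\dots,x_n)$, and let $IA_n=IA_{F_n}$. Let $IA_n^+\subseteq IA_n$ be the group of triangular automorphisms, that is, of the automorphisms $\varphi$ of $F_n$ such that, for every $i$, $$\varphi(x_i)=(w_i^{-1}x_iw_i)\,\gamma_i\quad\text{for some } w_i\in\langle x_j\rangle_{j<i} \text{ and } \gamma_i\in\Gamma_2(\langle x_j\rangle_{j<i}).$$ Then the subgroup $F_nIA_n^+ := \operatorname{Inn}(F_n)\cdot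 IA_n^+$ of $IA_n$, generated by the inner automorphisms and the triangular automorphisms, satisfies the Andreadakis equality. -/

import Mathlib

namespace AndreadakisProblem

/-- The term `Γ_j(K)` of the lower central series of a subgroup `K`, seen inside the ambient group,
with the usual numbering `Γ_1(K) = K`, `Γ_{j+1}(K) = [Γ_j(K), K]`. Only `j ≥ 1` is meaningful
(the unused value at `j = 0` is `K`). -/
def lcs {G : Type*} [Group G] (K : Subgroup G) (j : ℕ) : Subgroup G :=
  K.lowerCentralSeries (j - 1)

theorem lcs_one {G : Type*} [Group G] (K : Subgroup G) : lcs K 1 = K := rfl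

theorem lcs_succ {G : Type*} [Group G] (K : Subgroup G) (j : ℕ) (hj : 1 ≤ j) :
    lcs K (j + 1) = ⁅lcs K j, K⁆ := by
  obtain ⟨k, rfl⟩ := Nat.exists_eq_add_of_le' hj
  rfl

/-- Automorphisms preserve the lower central series of the whole group. -/
theorem map_mem_lcs_top {G : Type*} [Group G] (φ : MulAut G) (j : ℕ) {g : G}
    (hg : g ∈ lcs (⊤ : Subgroup G) j) : φ g ∈ lcs (⊤ : Subgroup G) j := by
  have key : ∀ k : ℕ, ((⊤ : Subgroup G).lowerCentralSeries k).map φ.toMonoidHom ≤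
      (⊤ : Subgroup G).lowerCentralSeries k := by
    intro k
    induction k with
    | zero => exact le_top
    | succ k ih =>
      change Subgroup.map _ ⁅_, _⁆ ≤ ⁅_, _⁆
      rw [Subgroup.map_commutator]
      exact Subgroup.commutator_mono ih le_top
  exact key _ (Subgroup.mem_map_of_mem φ.toMonoidHom hg)

/-- The Andreadakis filtration of a group `G`: `A_j` is the group of automorphisms `φ` of `G` such
that `φ(h) h⁻¹ ∈ Γ_{i+j}(G)` for all `i ≥ 1` and all `h ∈ Γ_i(G)`. -/
def andreadakisFiltration (G : Type*) [Group G] (j : ℕ) : Subgroup (MulAut G) where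
  carrier := {φ | ∀ i : ℕ, 1 ≤ i → ∀ h ∈ lcs (⊤ : Subgroup G) i,
    φ h * h⁻¹ ∈ lcs (⊤ : Subgroup G) (i + j)}
  one_mem' := by
    intro i _ h _
    simp [one_mem]
  mul_mem' := by
    intro φ ψ hφ hψ i hi h hh
    have h1 := map_mem_lcs_top φ _ (hψ i hi h hh)
    have h2 := mul_mem h1 (hφ i hi h hh)
    simpa [mul_assoc] using h2
  inv_mem' := by
    intro φ hφ i hi h hh
    have h1 := map_mem_lcs_top φ⁻¹ _ (inv_mem (hφ i hi h hh))
    simpa using h1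

/-- `IA_G`: the automorphisms of `G` acting trivially on the abelianization of `G`. -/
def IA (G : Type*) [Group G] : Subgroup (MulAut G) where
  carrier := {φ | ∀ g : G, Abelianization.of (φ g) = Abelianization.of g}
  one_mem' := by
    intro g
    rfl
  mul_mem' := by
    intro φ ψ hφ hψ g
    exact (hφ (ψ g)).trans (hψ g)
  inv_mem' := by
    intro φ hφ g
    have h := hφ (φ⁻¹ g)
    rw [MulAut.apply_inv_self] at h
    exact h.symm

/-- A subgroup `K` of `IA_G` satisfies the Andreadakis equality when the inclusions
`Γ_j(K) ⊆ K ∩ Γ_j(IA_G) ⊆ K ∩ A_j` are equalities for all `j ≥ 1`. -/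
def SatisfiesAndreadakisEquality {G : Type*} [Group G] (K : Subgroup (MulAut G)) : Prop :=
  K ≤ IA G ∧ ∀ j : ℕ, 1 ≤ j →
    lcs K j = K ⊓ lcs (IA G) j ∧ K ⊓ lcs (IA G) j = K ⊓ andreadakisFiltration G j

/-- `Inn(G)`, the group of inner automorphisms. -/
def inn (G : Type*) [Group G] : Subgroup (MulAut G) :=
  (MulAut.conj : G →* MulAut G).range

section Triangular

variable {n : ℕ} {F : Type*} [Group F] (b : FreeGroupBasis (Fin n) F)

/-- The subgroup of `F` generated by the elements of the basis `b` of index `< k`. -/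
def initialSubgroup (k : ℕ) : Subgroup F :=
  Subgroup.closure (b '' {j : Fin n | (j : ℕ) < k})

/-- `φ` acts as `x_i ↦ (w⁻¹ x_i w) γ`, where `w` is in `⟨x_j⟩_{j < i}` and `γ` is in the derived
subgroup of `⟨x_j⟩_{j < i}`, both depending on `i`. -/
def IsTriangular (φ : MulAut F) : Prop :=
  ∀ i : Fin n, ∃ w ∈ initialSubgroup b i, ∃ γ ∈ lcs (initialSubgroup b i) 2,
    φ (b i) = (w⁻¹ * b i * w) * γ

theorem lcs_two {G : Type*} [Group G] (K : Subgroup G) : lcs K 2 = ⁅K, K⁆ := rfl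

theorem conj_mem_lcs_two {G : Type*} [Group G] (K : Subgroup G) {x d : G} (hx : x ∈ K)
    (hd : d ∈ lcs K 2) : x * d * x⁻¹ ∈ lcs K 2 := by
  rw [lcs_two] at *
  have hdK : d ∈ K := Subgroup.commutator_le_self K hd
  have h := mul_mem (Subgroup.commutator_mem_commutator hx hdK) hd
  simpa [commutatorElement_def] using h

theorem initialSubgroup_mono {k l : ℕ} (h : k ≤ l) :
    initialSubgroup b k ≤ initialSubgroup b l :=
  Subgroup.closure_mono (Set.image_mono fun _ hj => lt_of_lt_of_le hj h)

theorem basis_mem_initialSubgroup (i : Fin n) {k : ℕ} (h : (i : ℕ) < k) :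
    b i ∈ initialSubgroup b k :=
  Subgroup.subset_closure ⟨i, h, rfl⟩

theorem IsTriangular.map_initialSubgroup {φ : MulAut F} (hφ : IsTriangular b φ) (k : ℕ) :
    (initialSubgroup b k).map φ.toMonoidHom = initialSubgroup b k := by
  induction k using Nat.strong_induction_on with
  | _ k ih =>
    apply le_antisymm
    · rw [initialSubgroup, MonoidHom.map_closure, Subgroup.closure_le]
      rintro _ ⟨_, ⟨i, hi, rfl⟩, rfl⟩
      obtain ⟨w, hw, γ, hγ, h⟩ := hφ i
      have hle := initialSubgroup_mono b (le_of_lt hi)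
      have hγ' := hle (Subgroup.commutator_le_self _ hγ)
      have hx := basis_mem_initialSubgroup b i hi
      change φ (b i) ∈ initialSubgroup b k
      rw [h]
      exact mul_mem (mul_mem (mul_mem (inv_mem (hle hw)) hx) (hle hw)) hγ'
    · rw [initialSubgroup, Subgroup.closure_le]
      rintro _ ⟨i, hi, rfl⟩
      obtain ⟨w, hw, γ, hγ, h⟩ := hφ i
      have hle : initialSubgroup b i ≤ (initialSubgroup b k).map φ.toMonoidHom := by
        rw [← ih i hi]
        exact Subgroup.map_mono (initialSubgroup_mono b (le_of_lt hi))
      have hγ' := hle (Subgroup.commutator_le_self _ hγ)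
      have hx : φ (b i) ∈ (initialSubgroup b k).map φ.toMonoidHom :=
        Subgroup.mem_map_of_mem φ.toMonoidHom (basis_mem_initialSubgroup b i hi)
      have e : b i = w * (φ (b i) * γ⁻¹) * w⁻¹ := by
        rw [h]
        group
      change b i ∈ (initialSubgroup b k).map φ.toMonoidHom
      rw [e]
      exact mul_mem (mul_mem (hle hw) (mul_mem hx (inv_mem hγ'))) (inv_mem (hle hw))

theorem IsTriangular.map_lcs_two {φ : MulAut F} (hφ : IsTriangular b φ) (k : ℕ) :
    (lcs (initialSubgroup b k) 2).map φ.toMonoidHom = lcs (initialSubgroup b k) 2 := by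
  rw [lcs_two, Subgroup.map_commutator, hφ.map_initialSubgroup]

theorem inv_apply_mem {H : Subgroup F} {φ : MulAut F} (h : H.map φ.toMonoidHom = H) {x : F}
    (hx : x ∈ H) : φ⁻¹ x ∈ H := by
  rw [← h] at hx
  obtain ⟨y, hy, rfl⟩ := hx
  change φ⁻¹ (φ y) ∈ H
  rwa [MulAut.inv_apply_self]

theorem apply_mem {H : Subgroup F} {φ : MulAut F} (h : H.map φ.toMonoidHom = H) {x : F}
    (hx : x ∈ H) : φ x ∈ H := by
  rw [← h]
  exact Subgroup.mem_map_of_mem φ.toMonoidHom hx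

/-- `IA_n⁺`, the group of triangular automorphisms with respect to the ordered basis `b`. -/
def triangularSubgroup : Subgroup (MulAut F) where
  carrier := {φ | IsTriangular b φ}
  one_mem' := by
    intro i
    exact ⟨1, one_mem _, 1, one_mem _, by simp⟩
  mul_mem' := by
    intro φ ψ hφ hψ i
    obtain ⟨w, hw, γ, hγ, h⟩ := hψ i
    obtain ⟨u, hu, δ, hδ, h'⟩ := hφ i
    have hw' := apply_mem (hφ.map_initialSubgroup b i) hw
    have hγ' := apply_mem (hφ.map_lcs_two b i) hγ
    refine ⟨u * φ w, mul_mem hu hw', ((φ w)⁻¹ * δ * (φ w)⁻¹⁻¹) * φ γ,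
      mul_mem (conj_mem_lcs_two _ (inv_mem hw') hδ) hγ', ?_⟩
    rw [MulAut.mul_apply, h]
    simp only [map_mul, map_inv, h']
    group
  inv_mem' := by
    intro φ hφ i
    obtain ⟨w, hw, γ, hγ, h⟩ := hφ i
    have hw' := inv_apply_mem (hφ.map_initialSubgroup b i) hw
    have hγ' := inv_apply_mem (hφ.map_lcs_two b i) hγ
    refine ⟨(φ⁻¹ w)⁻¹, inv_mem hw', φ⁻¹ w * (φ⁻¹ γ)⁻¹ * (φ⁻¹ w)⁻¹,
      conj_mem_lcs_two _ hw' (inv_mem hγ'), ?_⟩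
    have e := congrArg (fun x => φ⁻¹ x) h
    simp only [MulAut.inv_apply_self, map_mul, map_inv] at e
    generalize φ⁻¹ (b i) = y at *
    rw [e]
    group

end Triangular

end AndreadakisProblem

/-! Since `Γ_j(IA) ⊆ A_j` for every group, only `K ∩ A_j ⊆ Γ_j(K)` has to be proved
(`satisfiesAndreadakisEquality_of_le`). The arithmetic input is the centralizer of a basis element
`x` of a free group: if `[g, x] ∈ Γ_{j+1}`, then `g ∈ Γ_j · ⟨x⟩` (`mul_zpow_inv_mem_lcs`).

For `K = IA_n⁺`, let `φ ∈ K ∩ A_j` send `x_k` to `(w⁻¹ x_k w) γ`. Killing the `x_i` with `i ≥ k`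
shows `γ ∈ Γ_{j+1}(⟨x_i⟩_{i<k})`; then `[w⁻¹, x_k] ∈ Γ_{j+1}`, and the centralizer result followed
by the same retraction gives `w ∈ Γ_j(⟨x_i⟩_{i<k})`. The automorphism changing only `x_k` in this
way lies in `Γ_j(K)`, so it can be divided out, one basis element after another
(`triangularSubgroup_inf_le_lcs`). For `c_g ψ` in the larger group, with `ψ` triangular, `ψ` fixes
the first basis element `x_0`. Hence `[g, x_0] ∈ Γ_{j+1}` and `g ∈ Γ_j · ⟨x_0⟩`. As conjugation by
`x_0` is triangular, the power of `x_0` is absorbed into `ψ`.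

The centralizer result is read off the Magnus expansions of `g x` and `x g`, given that an element
with no Magnus terms in degrees `1, …, m - 1` lies in `Γ_m`. That fact follows from the equality of
the dimension and lower central filtrations of a free group, proved here for weighted generators
because weights make Lazard elimination an induction (`mem_weightedLCS_of_sub_one_mem`). -/

namespace AndreadakisProblem

open scoped commutatorElement

universe u

/-! ### Filtrations of rings and N-series of groups -/

/-- A descending multiplicative filtration of a ring by additive subgroups. -/
structure IsRingFiltration {R : Type*} [Ring R] (E : ℕ → AddSubgroup R) : Prop where
  antitone : Antitone E
  one_mem : 1 ∈ E 0
  mul_mem : ∀ {i j : ℕ} {a b : R}, a ∈ E i → b ∈ E j → a * b ∈ E (i + j)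

/-- An N-series of a group, starting at the whole group in degree `0`. -/
structure IsNSeries {G : Type*} [Group G] (S : ℕ → Subgroup G) : Prop where
  zero_eq : S 0 = ⊤
  antitone : Antitone S
  commutator_le : ∀ i j : ℕ, ⁅S i, S j⁆ ≤ S (i + j)

theorem IsNSeries.comap {G H : Type*} [Group G] [Group H] {S : ℕ → Subgroup H}
    (hS : IsNSeries S) (f : G →* H) : IsNSeries fun j => (S j).comap f where
  zero_eq := by simp [hS.zero_eq]
  antitone _ _ h := Subgroup.comap_mono (hS.antitone h)
  commutator_le i j := by
    rw [Subgroup.commutator_le]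
    intro a ha b hb
    rw [Subgroup.mem_comap, map_commutatorElement]
    exact hS.commutator_le i j (Subgroup.commutator_mem_commutator ha hb)

theorem IsRingFiltration.comap {R R' : Type*} [Ring R] [Ring R'] {E : ℕ → AddSubgroup R'}
    (hE : IsRingFiltration E) (f : R →+* R') :
    IsRingFiltration fun j => (E j).comap f.toAddMonoidHom where
  antitone _ _ h := AddSubgroup.comap_mono (hE.antitone h)
  one_mem := by simpa using hE.one_mem
  mul_mem {i j a b} ha hb := by
    have := hE.mul_mem (a := f a) (b := f b) ha hb
    simpa using this

/-- The elements of a group which act as the identity modulo the `j`-th term of a filtration. -/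
def congruenceSubgroup {G R : Type*} [Group G] [Ring R] {E : ℕ → AddSubgroup R}
    (hE : IsRingFiltration E) (ρ : G →* R) (hρ : ∀ g, ρ g ∈ E 0) (j : ℕ) : Subgroup G where
  carrier := {g | ρ g - 1 ∈ E j}
  one_mem' := by simp
  mul_mem' {a b} ha hb := by
    have h1 := hE.mul_mem (hρ a) hb
    rw [zero_add] at h1
    have h2 := add_mem h1 ha
    simpa [mul_sub] using h2
  inv_mem' {a} ha := by
    have h1 := neg_mem (hE.mul_mem (hρ a⁻¹) ha)
    rw [zero_add] at h1
    have h2 : ρ a⁻¹ * ρ a = 1 := by rw [← map_mul]; simp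
    simpa [mul_sub, h2] using h1

/-- With `a`, `b` standing for their images, `[a, b] - 1 = (ab - ba) a⁻¹ b⁻¹`, and `ab - ba` is the
ring commutator of `a - 1` and `b - 1`. -/
theorem isNSeries_congruenceSubgroup {G R : Type*} [Group G] [Ring R] {E : ℕ → AddSubgroup R}
    (hE : IsRingFiltration E) (ρ : G →* R) (hρ : ∀ g, ρ g ∈ E 0) :
    IsNSeries (congruenceSubgroup hE ρ hρ) where
  zero_eq := by
    rw [eq_top_iff]
    intro g _
    exact sub_mem (hρ g) hE.one_mem
  antitone _ _ h _ hg := hE.antitone h hg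
  commutator_le i j := by
    rw [Subgroup.commutator_le]
    intro a ha b hb
    have h1 := sub_mem (hE.mul_mem ha hb) (add_comm j i ▸ hE.mul_mem hb ha)
    have h2 := hE.mul_mem h1 (hρ (a⁻¹ * b⁻¹))
    change ρ ⁅a, b⁆ - 1 ∈ E (i + j)
    rw [add_zero] at h2
    convert h2 using 1
    have e1 : ρ ⁅a, b⁆ = ρ a * ρ b * ρ (a⁻¹ * b⁻¹) := by
      rw [← map_mul, ← map_mul, commutatorElement_def]; congr 1; group
    have e2 : (1 : R) = ρ b * ρ a * ρ (a⁻¹ * b⁻¹) := by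
      rw [← map_mul, ← map_mul, ← map_one ρ]; congr 1; group
    have e3 : (ρ a - 1) * (ρ b - 1) - (ρ b - 1) * (ρ a - 1) = ρ a * ρ b - ρ b * ρ a := by
      noncomm_ring
    rw [e3, sub_mul, ← e1, ← e2]

/-- The filtration of the endomorphisms of an abelian group by their degree with respect to a
filtration of that group. -/
def endFiltration {M : Type*} [AddCommGroup M] (D : ℕ → AddSubgroup M) (j : ℕ) :
    AddSubgroup (Module.End ℤ M) where
  carrier := {e | ∀ i, ∀ a ∈ D i, e a ∈ D (i + j)}
  zero_mem' := by intro i a _; simp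
  add_mem' he hf := by
    intro i a ha
    exact add_mem (he i a ha) (hf i a ha)
  neg_mem' he := by
    intro i a ha
    exact neg_mem (he i a ha)

theorem isRingFiltration_endFiltration {M : Type*} [AddCommGroup M] {D : ℕ → AddSubgroup M}
    (hD : Antitone D) : IsRingFiltration (endFiltration D) where
  antitone _ _ h _ he i a ha := hD (by omega) (he i a ha)
  one_mem := by intro i a ha; simpa using ha
  mul_mem {j k e f} he hf := by
    intro i a ha
    have := he _ _ (hf i a ha)
    rwa [add_right_comm, add_assoc] at this

/-! ### Weighted filtrations of a free group and of its group ring -/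

section Weighted

variable {X : Type u} (w : X → ℕ)

/-- The integral group ring of the free group on `X`. -/
abbrev FreeGroupRing (X : Type u) : Type u := MonoidAlgebra ℤ (FreeGroup X)

/-- A free group element, seen in the group ring. -/
noncomputable abbrev toRing {X : Type u} : FreeGroup X →* FreeGroupRing X := MonoidAlgebra.of ℤ (FreeGroup X)

/-- The smallest filtration of the group ring for which `x - 1` has degree `w x`. -/
noncomputable def weightedIdeal (m : ℕ) : AddSubgroup (FreeGroupRing X) :=
  ⨅ E : {E : ℕ → AddSubgroup (FreeGroupRing X) // IsRingFiltration E ∧ E 0 = ⊤ ∧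
    ∀ x, toRing (FreeGroup.of x) - 1 ∈ E (w x)}, E.1 m

/-- The smallest N-series of the free group for which `x` has degree `w x`. -/
def weightedLCS (m : ℕ) : Subgroup (FreeGroup X) :=
  ⨅ S : {S : ℕ → Subgroup (FreeGroup X) // IsNSeries S ∧ ∀ x, FreeGroup.of x ∈ S (w x)}, S.1 m

theorem weightedLCS_le {S : ℕ → Subgroup (FreeGroup X)} (hS : IsNSeries S)
    (h : ∀ x, FreeGroup.of x ∈ S (w x)) (m : ℕ) : weightedLCS w m ≤ S m :=
  iInf_le_of_le ⟨S, hS, h⟩ le_rfl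

theorem isNSeries_weightedLCS : IsNSeries (weightedLCS w) where
  zero_eq := by
    rw [eq_top_iff]
    refine le_iInf fun S => ?_
    rw [S.2.1.zero_eq]
  antitone _ _ h := iInf_mono fun S => S.2.1.antitone h
  commutator_le i j := le_iInf fun S =>
    (Subgroup.commutator_mono (iInf_le _ S) (iInf_le _ S)).trans (S.2.1.commutator_le i j)

theorem of_mem_weightedLCS (x : X) : FreeGroup.of x ∈ weightedLCS w (w x) := by
  rw [weightedLCS, Subgroup.mem_iInf]
  exact fun S => S.2.2 x

theorem weightedLCS_eq_top {m : ℕ} (h : ∀ x, m ≤ w x) : weightedLCS w m = ⊤ := by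
  rw [eq_top_iff, ← FreeGroup.closure_range_of, Subgroup.closure_le]
  rintro _ ⟨x, rfl⟩
  exact (isNSeries_weightedLCS w).antitone (h x) (of_mem_weightedLCS w x)

/-- Serves as the induction principle for `weightedIdeal`: a property is checked by packaging it as
a competing filtration. -/
theorem weightedIdeal_le {E : ℕ → AddSubgroup (FreeGroupRing X)} (hE : IsRingFiltration E)
    (h0 : E 0 = ⊤) (h : ∀ x, toRing (FreeGroup.of x) - 1 ∈ E (w x)) (m : ℕ) :
    weightedIdeal w m ≤ E m :=
  iInf_le_of_le ⟨E, hE, h0, h⟩ le_rfl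

theorem isRingFiltration_weightedIdeal : IsRingFiltration (weightedIdeal w) where
  antitone _ _ h := iInf_mono fun E => E.2.1.antitone h
  one_mem := by
    rw [weightedIdeal, AddSubgroup.mem_iInf]
    exact fun E => E.2.1.one_mem
  mul_mem {i j a b} ha hb := by
    rw [weightedIdeal, AddSubgroup.mem_iInf] at *
    exact fun E => E.2.1.mul_mem (ha E) (hb E)

theorem weightedIdeal_zero : weightedIdeal w 0 = ⊤ := by
  rw [eq_top_iff]
  refine le_iInf fun E => ?_
  rw [E.2.2.1]

theorem toRing_of_sub_one_mem (x : X) :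
    toRing (FreeGroup.of x) - 1 ∈ weightedIdeal w (w x) := by
  rw [weightedIdeal, AddSubgroup.mem_iInf]
  exact fun E => E.2.2.2 x

variable {w}

theorem mul_mem_weightedIdeal_right {m : ℕ} {a b : FreeGroupRing X}
    (hb : b ∈ weightedIdeal w m) : a * b ∈ weightedIdeal w m := by
  have h := (isRingFiltration_weightedIdeal w).mul_mem
    (show a ∈ weightedIdeal w 0 by simp [weightedIdeal_zero]) hb
  rwa [zero_add] at h

theorem mul_mem_weightedIdeal_left {m : ℕ} {a b : FreeGroupRing X}
    (ha : a ∈ weightedIdeal w m) : a * b ∈ weightedIdeal w m := by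
  have h := (isRingFiltration_weightedIdeal w).mul_mem ha
    (show b ∈ weightedIdeal w 0 by simp [weightedIdeal_zero])
  rwa [add_zero] at h

theorem freeGroup_mem_submonoid {X R : Type*} [Monoid R] (ρ : FreeGroup X →* R)
    (A : Submonoid R) (h : ∀ x, ρ (FreeGroup.of x) ∈ A) (h' : ∀ x, ρ (FreeGroup.of x)⁻¹ ∈ A)
    (g : FreeGroup X) : ρ g ∈ A := by
  induction g using FreeGroup.induction_on with
  | C1 => simp
  | of x => exact h x
  | inv_of x _ => exact h' x
  | mul a b ha hb => rw [map_mul]; exact mul_mem ha hb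

theorem addSubgroup_eq_top_of_toRing_mem {A : AddSubgroup (FreeGroupRing X)}
    (h : ∀ g, toRing g ∈ A) : A = ⊤ := by
  rw [eq_top_iff]
  intro a _
  induction a using MonoidAlgebra.induction_on with
  | of g => exact h g
  | add x y hx hy => exact add_mem (hx trivial) (hy trivial)
  | smul r x hx => exact zsmul_mem (hx trivial) r

theorem lift_mem_of_mem_weightedIdeal {R : Type*} [Ring R] {E : ℕ → AddSubgroup R}
    (hE : IsRingFiltration E) (ρ : FreeGroup X →* R) (hρ : ∀ g, ρ g ∈ E 0)
    (hw : ∀ x, ρ (FreeGroup.of x) - 1 ∈ E (w x)) {m : ℕ} {a : FreeGroupRing X}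
    (ha : a ∈ weightedIdeal w m) : MonoidAlgebra.lift ℤ R (FreeGroup X) ρ a ∈ E m := by
  refine weightedIdeal_le w (hE.comap (MonoidAlgebra.lift ℤ R (FreeGroup X) ρ).toRingHom)
    ?_ ?_ m ha
  · refine addSubgroup_eq_top_of_toRing_mem fun g => ?_
    rw [AddSubgroup.mem_comap]
    change MonoidAlgebra.lift ℤ R (FreeGroup X) ρ (toRing g) ∈ E 0
    rw [MonoidAlgebra.lift_of]
    exact hρ g
  · intro x
    rw [AddSubgroup.mem_comap]
    change MonoidAlgebra.lift ℤ R (FreeGroup X) ρ (toRing (FreeGroup.of x) - 1) ∈ E (w x)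
    rw [map_sub, MonoidAlgebra.lift_of, map_one]
    exact hw x

/-- If an endomorphism raises the degree of the generators by `c`, then it raises all degrees
by `c`. -/
theorem mapDomain_sub_mem (β : FreeGroup X →* FreeGroup X) {c : ℕ}
    (hβ : ∀ x, toRing (β (FreeGroup.of x)) - toRing (FreeGroup.of x) ∈ weightedIdeal w (w x + c))
    {j : ℕ} {a : FreeGroupRing X} (ha : a ∈ weightedIdeal w j) :
    MonoidAlgebra.mapDomainRingHom ℤ β a - a ∈ weightedIdeal w (j + c) := by
  set f := MonoidAlgebra.mapDomainRingHom ℤ β with hf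
  have hfg : ∀ g, f (toRing g) = toRing (β g) := fun g => by simp [hf]
  have hI := isRingFiltration_weightedIdeal w
  -- The elements satisfying the claim form a ring filtration, by the twisted Leibniz rule `f(ab) -
  -- ab = f(a)(f(b) - b) + (f(a) - a)b`.
  let J : ℕ → AddSubgroup (FreeGroupRing X) := fun j =>
    weightedIdeal w j ⊓
      (weightedIdeal w (j + c)).comap (f.toAddMonoidHom - AddMonoidHom.id _)
  have hmem : ∀ {j a}, a ∈ J j ↔ a ∈ weightedIdeal w j ∧ f a - a ∈ weightedIdeal w (j + c) :=
    Iff.rfl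
  have hJ : IsRingFiltration J := by
    refine ⟨fun i j h => inf_le_inf (hI.antitone h)
      (AddSubgroup.comap_mono (hI.antitone (by omega))), ?_, ?_⟩
    · rw [hmem]
      exact ⟨hI.one_mem, by simp⟩
    · intro i j a b ha hb
      rw [hmem] at *
      refine ⟨hI.mul_mem ha.1 hb.1, ?_⟩
      have h1 : f a ∈ weightedIdeal w i := by
        simpa using add_mem ha.1 (hI.antitone (Nat.le_add_right i c) ha.2)
      have h2 := hI.mul_mem h1 hb.2
      have h3 := hI.mul_mem ha.2 hb.1
      rw [← add_assoc] at h2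
      rw [add_right_comm] at h3
      convert add_mem h2 h3 using 1
      rw [map_mul]
      noncomm_ring
  have key : ∀ x, f (toRing (FreeGroup.of x)) - toRing (FreeGroup.of x) ∈
      weightedIdeal w (w x + c) := fun x => by
    rw [hfg]
    exact hβ x
  have h0 : J 0 = ⊤ := by
    let A : Submonoid (FreeGroupRing X) :=
      { carrier := J 0
        one_mem' := hJ.one_mem
        mul_mem' := fun {a b} ha hb => by
          have h := hJ.mul_mem (i := 0) (j := 0) ha hb
          rwa [zero_add] at h }
    have hI0 : ∀ a, a ∈ weightedIdeal w 0 := fun a => by simp [weightedIdeal_zero]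
    refine addSubgroup_eq_top_of_toRing_mem fun g =>
      freeGroup_mem_submonoid toRing A (fun x => ?_) (fun x => ?_) g
    · exact ⟨hI0 _, hI.antitone (by omega) (key x)⟩
    · refine ⟨hI0 _, ?_⟩
      -- For inverses: `β(x)⁻¹ - x⁻¹ = -β(x)⁻¹ (β(x) - x) x⁻¹`.
      have h1 := mul_mem_weightedIdeal_left (b := toRing (FreeGroup.of x)⁻¹)
        (mul_mem_weightedIdeal_right (a := toRing (β (FreeGroup.of x))⁻¹) (neg_mem (hβ x)))
      have h2 : toRing (β (FreeGroup.of x))⁻¹ *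
          -(toRing (β (FreeGroup.of x)) - toRing (FreeGroup.of x)) * toRing (FreeGroup.of x)⁻¹ =
          toRing (β (FreeGroup.of x)⁻¹) - toRing (FreeGroup.of x)⁻¹ := by
        rw [neg_sub, mul_sub, sub_mul, ← map_mul, ← map_mul, ← map_mul, ← map_mul, map_inv,
          inv_mul_cancel, mul_inv_cancel_right, one_mul]
      rw [h2, ← hfg] at h1
      exact hI.antitone (by omega) h1
  refine (hmem.1 (weightedIdeal_le w hJ h0 ?_ j ha)).2
  intro x
  refine ⟨toRing_of_sub_one_mem w x, ?_⟩
  have := key x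
  change f (toRing (FreeGroup.of x) - 1) - (toRing (FreeGroup.of x) - 1) ∈
    weightedIdeal w (w x + c)
  rwa [map_sub, map_one, sub_sub_sub_cancel_right]

/-- The exponent sum of a generator. -/
def exponent [DecidableEq X] (x : X) : FreeGroup X →* Multiplicative ℤ :=
  FreeGroup.lift fun y => if y = x then Multiplicative.ofAdd 1 else 1

/-- The unipotent representation of the free group given by an exponent sum. -/
noncomputable def dualExponent [DecidableEq X] (x : X) : FreeGroup X →* DualNumber ℤ where
  toFun g := TrivSqZeroExt.inl 1 + TrivSqZeroExt.inr (exponent x g).toAdd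
  map_one' := by simp
  map_mul' a b := by
    rw [TrivSqZeroExt.ext_iff]
    simp [add_comm]

/-- The representation `g ↦ 1 + e(g) ε` on the dual numbers is filtered once `ε` is given degree `w
x`, and nothing nonzero survives in degree `m > w x`. -/
theorem exponent_eq_one [DecidableEq X] {x : X} {m : ℕ} (hx : 1 ≤ w x) (hm : w x < m)
    {g : FreeGroup X} (hg : toRing g - 1 ∈ weightedIdeal w m) : exponent x g = 1 := by
  let E : ℕ → AddSubgroup (DualNumber ℤ) := fun j =>
    { carrier := {r | (1 ≤ j → r.fst = 0) ∧ (w x < j → r.snd = 0)}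
      zero_mem' := by simp
      add_mem' := by
        rintro a b ⟨h1, h2⟩ ⟨h3, h4⟩
        exact ⟨fun h => by simp [h1 h, h3 h], fun h => by simp [h2 h, h4 h]⟩
      neg_mem' := by
        rintro a ⟨h1, h2⟩
        exact ⟨fun h => by simp [h1 h], fun h => by simp [h2 h]⟩ }
  have hE : IsRingFiltration E := by
    refine ⟨?_, ?_, ?_⟩
    · rintro i j h a ⟨h1, h2⟩
      exact ⟨fun h => h1 (by omega), fun h => h2 (by omega)⟩
    · exact ⟨fun h => by omega, fun h => by omega⟩
    · rintro i j a b ⟨h1, h2⟩ ⟨h3, h4⟩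
      refine ⟨fun h => ?_, fun h => ?_⟩
      · rcases Nat.eq_zero_or_pos i with rfl | hi
        · simp [h3 (by omega)]
        · simp [h1 hi]
      · rw [TrivSqZeroExt.snd_mul]
        rcases Nat.eq_zero_or_pos i with rfl | hi
        · rw [h4 (by omega), h3 (by omega)]; simp
        · rcases Nat.eq_zero_or_pos j with rfl | hj
          · rw [h2 (by omega), h1 (by omega)]; simp
          · rw [h1 hi, h3 hj]; simp
  have h := lift_mem_of_mem_weightedIdeal (w := w) hE (dualExponent x)
    (fun g => ⟨fun h => by omega, fun h => by omega⟩) (fun y => ?_) hg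
  · have h2 := h.2 hm
    rw [map_sub, MonoidAlgebra.lift_of, map_one] at h2
    simpa [dualExponent] using h2
  · refine ⟨fun _ => by simp [dualExponent], fun h => ?_⟩
    have hne : y ≠ x := by rintro rfl; omega
    simp [dualExponent, exponent, hne]

end Weighted

/-! ### Lazard elimination of one generator -/

section Elimination

variable {X : Type u} (x : X) (w : X → ℕ)

/-- The generators of the kernel of the exponent sum of `x`: the pair `(y, k)` stands for an
iterated commutator of `y` with `k` factors `x` or `x⁻¹`, alternately. -/
abbrev EliminationIndex : Type u := {y : X // y ≠ x} × ℕ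

/-- The weights of the generators of the kernel of the exponent sum of `x`. -/
def eliminationWeight (p : EliminationIndex x) : ℕ := w p.1 + p.2 * w x

variable {x} in
/-- A generator of the kernel. -/
def kerGen (y : {y : X // y ≠ x}) (k : ℕ) : FreeGroup (EliminationIndex x) :=
  FreeGroup.of (y, k)

/-- The action of `x` by conjugation on the kernel of its exponent sum. -/
def conjHom : FreeGroup (EliminationIndex x) →* FreeGroup (EliminationIndex x) :=
  FreeGroup.lift fun p => kerGen p.1 p.2 *
    if Even p.2 then kerGen p.1 (p.2 + 1)
    else (kerGen p.1 (p.2 + 2))⁻¹ * (kerGen p.1 (p.2 + 1))⁻¹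

/-- The action of `x⁻¹` by conjugation on the kernel of the exponent sum of `x`. -/
def conjInvHom : FreeGroup (EliminationIndex x) →* FreeGroup (EliminationIndex x) :=
  FreeGroup.lift fun p => kerGen p.1 p.2 *
    if Even p.2 then (kerGen p.1 (p.2 + 2))⁻¹ * (kerGen p.1 (p.2 + 1))⁻¹
    else kerGen p.1 (p.2 + 1)

-- Write `c_k` for the generators; alternating `x` and `x⁻¹` makes conjugation by both of them
-- polynomial in the `c_k`. For odd `k`, conjugating `c_k c_{k+1} = x⁻¹ c_k x` by `x` gives `x c_k
-- x⁻¹ = c_k (x c_{k+1} x⁻¹)⁻¹`, and `k + 1` is even, so `x c_{k+1} x⁻¹ = c_{k+1} c_{k+2}`.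
variable {x} in
theorem conjHom_kerGen (y : {y : X // y ≠ x}) (k : ℕ) :
    conjHom x (kerGen y k) = kerGen y k * if Even k then kerGen y (k + 1)
      else (kerGen y (k + 2))⁻¹ * (kerGen y (k + 1))⁻¹ :=
  FreeGroup.lift_apply_of

variable {x} in
theorem conjInvHom_kerGen (y : {y : X // y ≠ x}) (k : ℕ) :
    conjInvHom x (kerGen y k) = kerGen y k * if Even k then
      (kerGen y (k + 2))⁻¹ * (kerGen y (k + 1))⁻¹ else kerGen y (k + 1) :=
  FreeGroup.lift_apply_of

/-- Conjugation by `x` as an automorphism. -/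
def conjEquiv : FreeGroup (EliminationIndex x) ≃* FreeGroup (EliminationIndex x) :=
  MonoidHom.toMulEquiv (conjHom x) (conjInvHom x)
    (by
      ext ⟨y, k⟩
      change conjInvHom x (conjHom x (kerGen y k)) = kerGen y k
      rw [conjHom_kerGen]
      split_ifs with hk
      · simp [conjInvHom_kerGen, hk, Nat.even_add_one]
        group
      · simp [conjInvHom_kerGen, hk, Nat.even_add_one, add_assoc]
        group)
    (by
      ext ⟨y, k⟩
      change conjHom x (conjInvHom x (kerGen y k)) = kerGen y k
      rw [conjInvHom_kerGen]
      split_ifs with hk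
      · simp [conjHom_kerGen, hk, Nat.even_add_one, add_assoc]
        group
      · simp [conjHom_kerGen, hk, Nat.even_add_one]
        group)

/-- The iterated commutators of `y` with `x` and `x⁻¹`. -/
def iteratedCommutator (y : X) : ℕ → FreeGroup X
  | 0 => FreeGroup.of y
  | k + 1 => (iteratedCommutator y k)⁻¹ * if Even k then
      FreeGroup.of x * iteratedCommutator y k * (FreeGroup.of x)⁻¹
      else (FreeGroup.of x)⁻¹ * iteratedCommutator y k * FreeGroup.of x

theorem iteratedCommutator_even (y : X) {k : ℕ} (hk : Even k) :
    iteratedCommutator x y (k + 1) = (iteratedCommutator x y k)⁻¹ *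
      (FreeGroup.of x * iteratedCommutator x y k * (FreeGroup.of x)⁻¹) := by
  rw [iteratedCommutator, if_pos hk]

theorem iteratedCommutator_odd (y : X) {k : ℕ} (hk : ¬ Even k) :
    iteratedCommutator x y (k + 1) = (iteratedCommutator x y k)⁻¹ *
      ((FreeGroup.of x)⁻¹ * iteratedCommutator x y k * FreeGroup.of x) := by
  rw [iteratedCommutator, if_neg hk]

/-- The inclusion of the kernel of the exponent sum of `x`. -/
def kerInclusion : FreeGroup (EliminationIndex x) →* FreeGroup X :=
  FreeGroup.lift fun p => iteratedCommutator x p.1 p.2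

variable {x} in
theorem kerInclusion_kerGen (y : {y : X // y ≠ x}) (k : ℕ) :
    kerInclusion x (kerGen y k) = iteratedCommutator x y k :=
  FreeGroup.lift_apply_of

theorem kerInclusion_conjEquiv (h : FreeGroup (EliminationIndex x)) :
    kerInclusion x (conjEquiv x h) = FreeGroup.of x * kerInclusion x h * (FreeGroup.of x)⁻¹ := by
  suffices H : (kerInclusion x).comp (conjHom x) =
      (MulAut.conj (FreeGroup.of x)).toMonoidHom.comp (kerInclusion x) from
    DFunLike.congr_fun H h
  ext ⟨y, k⟩
  change kerInclusion x (conjHom x (kerGen y k)) =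
    FreeGroup.of x * kerInclusion x (kerGen y k) * (FreeGroup.of x)⁻¹
  rw [conjHom_kerGen, map_mul, kerInclusion_kerGen]
  split_ifs with hk
  · rw [kerInclusion_kerGen, iteratedCommutator_even x y hk, mul_inv_cancel_left]
  · have hk' : Even (k + 1) := by rwa [Nat.even_add_one]
    rw [map_mul, map_inv, map_inv, kerInclusion_kerGen, kerInclusion_kerGen,
      iteratedCommutator_even x y hk', iteratedCommutator_odd x y hk]
    group

theorem kerGen_sub_one_mem (y : {y : X // y ≠ x}) {k j : ℕ} (h : j ≤ w y + k * w x) :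
    toRing (kerGen y k) - 1 ∈ weightedIdeal (eliminationWeight x w) j :=
  (isRingFiltration_weightedIdeal _).antitone h
    (toRing_of_sub_one_mem (eliminationWeight x w) (y, k))

variable {x w} in
theorem inv_mul_inv_sub_one_mem {Y : Type u} {v : Y → ℕ} {j : ℕ} {a b : FreeGroup Y}
    (ha : toRing a - 1 ∈ weightedIdeal v j) (hb : toRing b - 1 ∈ weightedIdeal v j) :
    toRing (b⁻¹ * a⁻¹) - 1 ∈ weightedIdeal v j := by
  have h1 := mul_mem_weightedIdeal_right (a := toRing (b⁻¹ * a⁻¹))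
    (neg_mem (add_mem (mul_mem_weightedIdeal_right (a := toRing a) hb) ha))
  convert h1 using 1
  have e : toRing (b⁻¹ * a⁻¹) * (toRing a * toRing b) = 1 := by
    rw [← map_mul, ← map_mul, ← map_one toRing]
    congr 1
    group
  rw [mul_sub, mul_one, sub_add_sub_cancel, mul_neg, mul_sub, e, mul_one, neg_sub]

/-- Conjugation multiplies `c_k` on the right by a word in `c_{k+1}` and `c_{k+2}` only, whose
weights exceed that of `c_k` by at least `w x`. -/
theorem conjHom_sub_mem (p : EliminationIndex x) :
    toRing (conjHom x (FreeGroup.of p)) - toRing (FreeGroup.of p) ∈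
      weightedIdeal (eliminationWeight x w) (eliminationWeight x w p + w x) := by
  obtain ⟨y, k⟩ := p
  change toRing (conjHom x (kerGen y k)) - toRing (kerGen y k) ∈
    weightedIdeal _ (w y + k * w x + w x)
  rw [conjHom_kerGen, map_mul, ← mul_sub_one]
  apply mul_mem_weightedIdeal_right
  split_ifs with hk
  · exact kerGen_sub_one_mem x w y (by linarith)
  · exact inv_mul_inv_sub_one_mem (kerGen_sub_one_mem x w y (by linarith))
      (kerGen_sub_one_mem x w y (by nlinarith))

theorem conjInvHom_sub_mem (p : EliminationIndex x) :
    toRing (conjInvHom x (FreeGroup.of p)) - toRing (FreeGroup.of p) ∈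
      weightedIdeal (eliminationWeight x w) (eliminationWeight x w p + w x) := by
  obtain ⟨y, k⟩ := p
  change toRing (conjInvHom x (kerGen y k)) - toRing (kerGen y k) ∈
    weightedIdeal _ (w y + k * w x + w x)
  rw [conjInvHom_kerGen, map_mul, ← mul_sub_one]
  apply mul_mem_weightedIdeal_right
  split_ifs with hk
  · exact inv_mul_inv_sub_one_mem (kerGen_sub_one_mem x w y (by linarith))
      (kerGen_sub_one_mem x w y (by nlinarith))
  · exact kerGen_sub_one_mem x w y (by linarith)

theorem iteratedCommutator_mem (y : X) (k : ℕ) :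
    iteratedCommutator x y k ∈ weightedLCS w (w y + k * w x) := by
  have hS := isNSeries_weightedLCS w
  have hx := of_mem_weightedLCS w x
  induction k with
  | zero => simpa [iteratedCommutator] using of_mem_weightedLCS w y
  | succ k ih =>
    have e : w y + (k + 1) * w x = w y + k * w x + w x := by ring
    rw [e]
    refine hS.commutator_le _ _ ?_
    by_cases hk : Even k
    · rw [iteratedCommutator_even x y hk]
      have := Subgroup.commutator_mem_commutator (inv_mem ih) hx
      simpa [commutatorElement_def, mul_assoc] using this
    · rw [iteratedCommutator_odd x y hk]
      have := Subgroup.commutator_mem_commutator (inv_mem ih) (inv_mem hx)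
      simpa [commutatorElement_def, mul_assoc] using this

theorem kerInclusion_mem {m : ℕ} {h : FreeGroup (EliminationIndex x)}
    (hh : h ∈ weightedLCS (eliminationWeight x w) m) : kerInclusion x h ∈ weightedLCS w m :=
  weightedLCS_le (eliminationWeight x w) ((isNSeries_weightedLCS w).comap (kerInclusion x))
    (fun p => by
      change kerInclusion x (kerGen p.1 p.2) ∈ weightedLCS w (w p.1 + p.2 * w x)
      rw [kerInclusion_kerGen]
      exact iteratedCommutator_mem x w p.1 p.2) m hh

variable [DecidableEq X]

/-- The action of the free group on the kernel of the exponent sum of `x`: the generator `x` acts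
by conjugation and the others by left multiplication. -/
def kerPerm : FreeGroup X →* Equiv.Perm (FreeGroup (EliminationIndex x)) :=
  FreeGroup.lift fun z =>
    if h : z = x then (conjEquiv x).toEquiv else Equiv.mulLeft (kerGen ⟨z, h⟩ 0)

theorem kerPerm_self (h : FreeGroup (EliminationIndex x)) :
    kerPerm x (FreeGroup.of x) h = conjEquiv x h := by
  rw [kerPerm, FreeGroup.lift_apply_of, dif_pos rfl]
  rfl

theorem kerPerm_of_ne {z : X} (hz : z ≠ x) (h : FreeGroup (EliminationIndex x)) :
    kerPerm x (FreeGroup.of z) h = kerGen ⟨z, hz⟩ 0 * h := by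
  rw [kerPerm, FreeGroup.lift_apply_of, dif_neg hz]
  rfl

theorem kerPerm_inv_self (h : FreeGroup (EliminationIndex x)) :
    kerPerm x (FreeGroup.of x)⁻¹ h = (conjEquiv x).symm h := by
  rw [map_inv, Equiv.Perm.inv_eq_iff_eq, kerPerm_self, MulEquiv.apply_symm_apply]

theorem kerPerm_inv_of_ne {z : X} (hz : z ≠ x) (h : FreeGroup (EliminationIndex x)) :
    kerPerm x (FreeGroup.of z)⁻¹ h = (kerGen ⟨z, hz⟩ 0)⁻¹ * h := by
  rw [map_inv, Equiv.Perm.inv_eq_iff_eq, kerPerm_of_ne x hz, mul_inv_cancel_left]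

/-- At `h = 1`, this gives an explicit preimage of `g` under `kerInclusion` whenever `g` has
exponent sum zero in `x`. No proof that the kernel is free on the iterated commutators is needed. -/
theorem kerInclusion_kerPerm (g : FreeGroup X) (h : FreeGroup (EliminationIndex x)) :
    kerInclusion x (kerPerm x g h) =
      g * kerInclusion x h * (FreeGroup.of x ^ (exponent x g).toAdd)⁻¹ := by
  induction g using FreeGroup.induction_on generalizing h with
  | C1 => simp
  | of z =>
    by_cases hz : z = x
    · subst hz
      rw [kerPerm_self, kerInclusion_conjEquiv]
      simp [exponent]
    · rw [kerPerm_of_ne x hz, map_mul, kerInclusion_kerGen, iteratedCommutator]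
      simp [exponent, hz]
  | inv_of z ih =>
    specialize ih (kerPerm x (FreeGroup.of z)⁻¹ h)
    rw [← Equiv.Perm.mul_apply, ← map_mul, mul_inv_cancel, map_one, Equiv.Perm.one_apply] at ih
    rw [ih, map_inv (exponent x), toAdd_inv, zpow_neg, inv_inv]
    simp only [mul_assoc, inv_mul_cancel, inv_mul_cancel_left, mul_one]
  | mul a b ha hb =>
    rw [map_mul, Equiv.Perm.mul_apply, ha, hb, map_mul, toAdd_mul, zpow_add]
    have := Commute.zpow_zpow (Commute.refl (FreeGroup.of x)) (exponent x a).toAdd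
      (exponent x b).toAdd
    rw [this.eq]
    group

/-- The linear extension of the action on the kernel to its group ring. -/
noncomputable def kerRep : FreeGroup X →* Module.End ℤ (FreeGroupRing (EliminationIndex x)) where
  toFun g := MonoidAlgebra.mapDomainLinearMap ℤ ℤ (kerPerm x g)
  map_one' := by
    ext a
    simp
  map_mul' a b := by
    ext a
    simp

theorem kerRep_toRing (g : FreeGroup X) (h : FreeGroup (EliminationIndex x)) :
    kerRep x g (toRing h) = toRing (kerPerm x g h) := by
  simp [kerRep]

theorem kerRep_self (a : FreeGroupRing (EliminationIndex x)) :
    kerRep x (FreeGroup.of x) a =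
      MonoidAlgebra.mapDomainRingHom ℤ (conjEquiv x).toMonoidHom a := by
  induction a using MonoidAlgebra.induction_on with
  | of g => rw [kerRep_toRing, kerPerm_self]; simp
  | add a b ha hb => rw [map_add, map_add, ha, hb]
  | smul r a ha => rw [map_zsmul, map_zsmul, ha]

theorem kerRep_inv_self (a : FreeGroupRing (EliminationIndex x)) :
    kerRep x (FreeGroup.of x)⁻¹ a =
      MonoidAlgebra.mapDomainRingHom ℤ (conjEquiv x).symm.toMonoidHom a := by
  induction a using MonoidAlgebra.induction_on with
  | of g => rw [kerRep_toRing, kerPerm_inv_self]; simp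
  | add a b ha hb => rw [map_add, map_add, ha, hb]
  | smul r a ha => rw [map_zsmul, map_zsmul, ha]

theorem kerRep_of_ne {z : X} (hz : z ≠ x) (a : FreeGroupRing (EliminationIndex x)) :
    kerRep x (FreeGroup.of z) a = toRing (kerGen ⟨z, hz⟩ 0) * a := by
  induction a using MonoidAlgebra.induction_on with
  | of g => rw [kerRep_toRing, kerPerm_of_ne x hz, map_mul]
  | add a b ha hb => rw [map_add, mul_add, ha, hb]
  | smul r a ha => rw [map_zsmul, mul_smul_comm, ha]

theorem kerRep_inv_of_ne {z : X} (hz : z ≠ x) (a : FreeGroupRing (EliminationIndex x)) :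
    kerRep x (FreeGroup.of z)⁻¹ a = toRing (kerGen ⟨z, hz⟩ 0)⁻¹ * a := by
  induction a using MonoidAlgebra.induction_on with
  | of g => rw [kerRep_toRing, kerPerm_inv_of_ne x hz, map_mul]
  | add a b ha hb => rw [map_add, mul_add, ha, hb]
  | smul r a ha => rw [map_zsmul, mul_smul_comm, ha]

theorem kerRep_mem (g : FreeGroup X) :
    kerRep x g ∈ endFiltration (weightedIdeal (eliminationWeight x w)) 0 := by
  have hI := isRingFiltration_weightedIdeal (eliminationWeight x w)
  have hE := isRingFiltration_endFiltration hI.antitone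
  let A : Submonoid (Module.End ℤ (FreeGroupRing (EliminationIndex x))) :=
    { carrier := endFiltration (weightedIdeal (eliminationWeight x w)) 0
      one_mem' := hE.one_mem
      mul_mem' := fun {a b} ha hb => by
        have h := hE.mul_mem (i := 0) (j := 0) ha hb
        rwa [zero_add] at h }
  refine freeGroup_mem_submonoid (kerRep x) A (fun z i a ha => ?_) (fun z i a ha => ?_) g
  · by_cases hz : z = x
    · subst hz
      rw [kerRep_self]
      have h := hI.antitone (Nat.le_add_right i (w z))
        (mapDomain_sub_mem (conjHom z) (conjHom_sub_mem z w) ha)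
      have h' := add_mem h ha
      rw [sub_add_cancel] at h'
      exact h'
    · rw [kerRep_of_ne x hz]
      exact mul_mem_weightedIdeal_right ha
  · by_cases hz : z = x
    · subst hz
      rw [kerRep_inv_self]
      have h := hI.antitone (Nat.le_add_right i (w z))
        (mapDomain_sub_mem (conjInvHom z) (conjInvHom_sub_mem z w) ha)
      have h' := add_mem h ha
      rw [sub_add_cancel] at h'
      exact h'
    · rw [kerRep_inv_of_ne x hz]
      exact mul_mem_weightedIdeal_right ha

/-- Conjugation by `x` raises degrees by `w x` by the computation on generators, while another
generator `z` acts as left multiplication by an element whose difference with `1` has degree `w z`.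
-/
theorem kerRep_sub_one_mem (z : X) : kerRep x (FreeGroup.of z) - 1 ∈
    endFiltration (weightedIdeal (eliminationWeight x w)) (w z) := by
  intro i a ha
  change kerRep x (FreeGroup.of z) a - a ∈ _
  by_cases hz : z = x
  · subst hz
    rw [kerRep_self]
    exact mapDomain_sub_mem (conjHom z) (conjHom_sub_mem z w) ha
  · rw [kerRep_of_ne x hz, ← sub_one_mul, add_comm i]
    exact (isRingFiltration_weightedIdeal _).mul_mem
      (kerGen_sub_one_mem x w ⟨z, hz⟩ (by simp)) ha

/-- The operator of `g - 1` raises degrees by `m`; it is applied to the vector `1`, of degree `0`.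
-/
theorem kerPerm_one_sub_one_mem {m : ℕ} {g : FreeGroup X}
    (hg : toRing g - 1 ∈ weightedIdeal w m) :
    toRing (kerPerm x g 1) - 1 ∈ weightedIdeal (eliminationWeight x w) m := by
  have hI := isRingFiltration_weightedIdeal (eliminationWeight x w)
  have h := lift_mem_of_mem_weightedIdeal (isRingFiltration_endFiltration hI.antitone)
    (kerRep x) (kerRep_mem x w) (kerRep_sub_one_mem x w) hg 0 1 hI.one_mem
  rw [zero_add, map_sub, MonoidAlgebra.lift_of, map_one (MonoidAlgebra.lift _ _ _ _),
    LinearMap.sub_apply, Module.End.one_apply, ← map_one toRing, kerRep_toRing, map_one toRing] at h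
  exact h

/-- As `m > w x`, the exponent sum of `g` in `x` vanishes, so `g` comes from the kernel, to which
the hypothesis `ih` applies. -/
theorem mem_weightedLCS_of_elimination {m : ℕ} (hx : 1 ≤ w x) (hm : w x < m)
    (ih : ∀ h : FreeGroup (EliminationIndex x),
      toRing h - 1 ∈ weightedIdeal (eliminationWeight x w) m →
        h ∈ weightedLCS (eliminationWeight x w) m)
    {g : FreeGroup X} (hg : toRing g - 1 ∈ weightedIdeal w m) : g ∈ weightedLCS w m := by
  have h := kerInclusion_mem x w (ih _ (kerPerm_one_sub_one_mem x w hg))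
  rw [kerInclusion_kerPerm, exponent_eq_one hx hm hg] at h
  simpa using h

end Elimination

/-- Double induction: all weights are at least `m - d`, and `c` generators have exactly that weight.
Eliminating one of these lowers `c`, because the new commutators are strictly heavier; when `c`
reaches `0`, `d` drops. At `d = 0` every generator already has weight at least `m`. -/
theorem mem_weightedLCS_of_sub_one_mem {X : Type u} (w : X → ℕ) (hw : ∀ x, 1 ≤ w x) {m : ℕ}
    (hfin : {x | w x < m}.Finite) {g : FreeGroup X} (hg : toRing g - 1 ∈ weightedIdeal w m) :
    g ∈ weightedLCS w m := by
  classical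
  suffices H : ∀ d c : ℕ, ∀ (X : Type u) (w : X → ℕ), (∀ x, 1 ≤ w x) → {x | w x < m}.Finite →
      (∀ x, m ≤ w x + d) → {x | w x + d = m}.ncard = c → ∀ g : FreeGroup X,
      toRing g - 1 ∈ weightedIdeal w m → g ∈ weightedLCS w m from
    H m _ X w hw hfin (fun x => by omega) rfl g hg
  intro d
  induction d with
  | zero =>
    intro c X w _ _ hm _ g _
    rw [weightedLCS_eq_top w (fun x => by simpa using hm x)]
    trivial
  | succ d ihd =>
    intro c
    induction c with
    | zero =>
      intro X w hw hfin hm hc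
      refine ihd _ X w hw hfin (fun x => ?_) rfl
      have hf : {x | w x + (d + 1) = m}.Finite := hfin.subset fun x hx => by
        simp only [Set.mem_ofPred_eq] at *; omega
      rw [Set.ncard_eq_zero hf] at hc
      have h1 : x ∉ {x | w x + (d + 1) = m} := by rw [hc]; simp
      have h2 := hm x
      simp only [Set.mem_ofPred_eq] at h1
      omega
    | succ c ihc =>
      intro X w hw hfin hm hc g hg
      obtain ⟨x, hx⟩ : {x | w x + (d + 1) = m}.Nonempty :=
        Set.nonempty_of_ncard_ne_zero (by omega)
      have hx' : w x + (d + 1) = m := hx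
      have hle : ∀ p : EliminationIndex x, w p.1 ≤ eliminationWeight x w p := fun p =>
        Nat.le_add_right _ _
      have hk : ∀ p : EliminationIndex x, p.2 ≤ eliminationWeight x w p := fun p =>
        (Nat.le_mul_of_pos_right _ (hw x)).trans (Nat.le_add_left _ _)
      refine mem_weightedLCS_of_elimination x w (hw x) (by omega) ?_ hg
      refine ihc _ _ (fun p => (hw _).trans (hle p)) ?_ (fun p => (hm p.1).trans ?_) ?_
      -- Elimination creates infinitely many generators, but `k ≤ k * w x` leaves only finitely many
      -- of weight less than `m`.
      · refine ((hfin.preimage Subtype.val_injective.injOn).prod (Set.finite_lt_nat m)).subset ?_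
        intro p hp
        exact ⟨lt_of_le_of_lt (hle p) hp, lt_of_le_of_lt (hk p) hp⟩
      · have := hle p
        omega
      -- Minimal weight forces `k = 0`, so the new minimal generators are the old ones other than
      -- `x`.
      · have himage : {x | w x + (d + 1) = m} \ {x} = (fun p : EliminationIndex x => (p.1 : X)) ''
            {p | eliminationWeight x w p + (d + 1) = m} := by
          ext y
          constructor
          · rintro ⟨hy, hyx⟩
            exact ⟨(⟨y, hyx⟩, 0), by simpa [eliminationWeight] using hy, rfl⟩
          · rintro ⟨p, hp, rfl⟩
            have h1 := hle p
            have h2 := hm p.1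
            have hp' : eliminationWeight x w p + (d + 1) = m := hp
            exact ⟨show w p.1 + (d + 1) = m by omega, p.1.2⟩
        have hinj : Set.InjOn (fun p : EliminationIndex x => (p.1 : X))
            {p | eliminationWeight x w p + (d + 1) = m} := by
          have hzero : ∀ p : EliminationIndex x, eliminationWeight x w p + (d + 1) = m →
              p.2 = 0 := by
            intro p hp
            have h2 := hm p.1
            rw [eliminationWeight] at hp
            have h3 : p.2 * w x = 0 := by omega
            have := hw x
            rcases Nat.mul_eq_zero.1 h3 with h | h
            · exact h
            · omega
          intro p hp q hq hpq
          exact Prod.ext (Subtype.ext hpq) ((hzero p hp).trans (hzero q hq).symm)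
        rw [← hinj.ncard_image, ← himage, Set.ncard_sdiff_singleton_of_mem hx, hc]
        rfl

/-! ### Lower central series -/

section LowerCentralSeries

variable {G : Type*} [Group G]

theorem lcs_antitone (K : Subgroup G) {i j : ℕ} (h : i ≤ j) : lcs K j ≤ lcs K i :=
  K.lowerCentralSeries_antitone (by omega)

theorem lcs_mono {K L : Subgroup G} (h : K ≤ L) (j : ℕ) : lcs K j ≤ lcs L j :=
  Subgroup.lowerCentralSeries_mono _ h

theorem map_lcs {H : Type*} [Group H] (f : G →* H) (K : Subgroup G) (j : ℕ) :
    (lcs K j).map f = lcs (K.map f) j :=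
  K.map_lowerCentralSeries f _

instance lcs_top_normal (j : ℕ) : (lcs (⊤ : Subgroup G) j).Normal := by
  unfold lcs
  infer_instance

/-- The lower central series is the fastest descending series `S` with `[S_j, K] ≤ S_{j+1}`. -/
theorem lcs_le_of_commutator_le {K : Subgroup G} {S : ℕ → Subgroup G} (h1 : K ≤ S 1)
    (h : ∀ j, 1 ≤ j → ⁅S j, K⁆ ≤ S (j + 1)) {j : ℕ} (hj : 1 ≤ j) : lcs K j ≤ S j := by
  induction j, hj using Nat.le_induction with
  | base => exact h1
  | succ j hj ih =>
    rw [lcs_succ K j hj]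
    exact (Subgroup.commutator_mono ih le_rfl).trans (h j hj)

theorem IsNSeries.lcs_le {S : ℕ → Subgroup G} (hS : IsNSeries S) {K : Subgroup G}
    (h : K ≤ S 1) {j : ℕ} (hj : 1 ≤ j) : lcs K j ≤ S j :=
  lcs_le_of_commutator_le h
    (fun j _ => (Subgroup.commutator_mono le_rfl h).trans (hS.commutator_le j 1)) hj

/-- The three subgroups lemma modulo a normal subgroup. -/
theorem commutator_commutator_le_of_rotate {A B C N : Subgroup G} [N.Normal]
    (h1 : ⁅⁅B, C⁆, A⁆ ≤ N) (h2 : ⁅⁅C, A⁆, B⁆ ≤ N) : ⁅⁅A, B⁆, C⁆ ≤ N := by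
  have key : ∀ L : Subgroup G, L ≤ N ↔ L.map (QuotientGroup.mk' N) = ⊥ := fun L => by
    rw [Subgroup.map_eq_bot_iff, QuotientGroup.ker_mk']
  rw [key, Subgroup.map_commutator, Subgroup.map_commutator] at *
  exact Subgroup.commutator_commutator_eq_bot_of_rotate h1 h2

theorem commutator_lcs_top_le {i j : ℕ} (hi : 1 ≤ i) (hj : 1 ≤ j) :
    ⁅lcs (⊤ : Subgroup G) i, lcs (⊤ : Subgroup G) j⁆ ≤ lcs (⊤ : Subgroup G) (i + j) := by
  induction j, hj using Nat.le_induction generalizing i with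
  | base => rw [lcs_succ _ _ hi, lcs_one]
  | succ j hj ih =>
    rw [lcs_succ _ j hj, Subgroup.commutator_comm]
    refine commutator_commutator_le_of_rotate (A := lcs ⊤ j) (B := ⊤) (C := lcs ⊤ i) ?_ ?_
    · rw [Subgroup.commutator_comm ⊤, ← lcs_succ _ i hi]
      exact (ih (by omega)).trans (lcs_antitone _ (by omega))
    · rw [← add_assoc, lcs_succ _ (i + j) (by omega)]
      exact Subgroup.commutator_mono (ih hi) le_rfl

theorem isNSeries_lcs_top : IsNSeries fun j => lcs (⊤ : Subgroup G) j where
  -- The truncated subtraction `0 - 1 = 0` makes the term of index `0` the whole group.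
  zero_eq := rfl
  antitone _ _ h := lcs_antitone _ h
  commutator_le i j := by
    rcases Nat.eq_zero_or_pos i with rfl | hi
    · rw [zero_add]
      exact Subgroup.commutator_le_right _ _
    · rcases Nat.eq_zero_or_pos j with rfl | hj
      · exact Subgroup.commutator_le_left _ _
      · exact commutator_lcs_top_le hi hj

end LowerCentralSeries

/-! ### Magnus expansion and Magnus' theorem -/

section Magnus

variable {X : Type u}

/-- The power series `1`. -/
def oneSeries : List X → ℤ
  | [] => 1
  | _ :: _ => 0

theorem oneSeries_of_ne_nil {v : List X} (hv : v ≠ []) : oneSeries v = 0 := by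
  cases v with
  | nil => exact absurd rfl hv
  | cons => rfl

/-- The power series with no term of degree less than `j`. -/
def seriesFiltration (X : Type u) (j : ℕ) : AddSubgroup (List X → ℤ) where
  carrier := {f | ∀ v, v.length < j → f v = 0}
  zero_mem' := by simp
  add_mem' ha hb v hv := by simp [ha v hv, hb v hv]
  neg_mem' ha v hv := by simp [ha v hv]

theorem seriesFiltration_antitone : Antitone (seriesFiltration X) :=
  fun _ _ h _ hf v hv => hf v (lt_of_lt_of_le hv h)

theorem sub_one_mul_mem {m : ℕ} (x : X) {a : FreeGroupRing X}
    (ha : a ∈ weightedIdeal (fun _ => 1) m) :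
    (toRing (FreeGroup.of x) - 1) * a ∈ weightedIdeal (fun _ : X => 1) (m + 1) := by
  rw [add_comm]
  exact (isRingFiltration_weightedIdeal _).mul_mem (toRing_of_sub_one_mem (fun _ => 1) x) ha

section Truncation

variable [Fintype X]

/-- The truncation of a noncommutative power series, evaluated at the elements `x - 1` of the
group ring. -/
noncomputable def evalTruncation : ℕ → (List X → ℤ) → FreeGroupRing X
  | 0, _ => 0
  | m + 1, f => (f [] : FreeGroupRing X) +
      ∑ x, (toRing (FreeGroup.of x) - 1) * evalTruncation m fun v => f (x :: v)

theorem evalTruncation_add (m : ℕ) (f g : List X → ℤ) :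
    evalTruncation m (f + g) = evalTruncation m f + evalTruncation m g := by
  induction m generalizing f g with
  | zero => simp [evalTruncation]
  | succ m ih =>
    have e : ∀ x, (fun v => (f + g) (x :: v)) = (fun v => f (x :: v)) + fun v => g (x :: v) :=
      fun x => rfl
    rw [evalTruncation, evalTruncation, evalTruncation]
    simp only [e, ih, mul_add, Finset.sum_add_distrib]
    rw [Pi.add_apply, Int.cast_add]
    exact add_add_add_comm _ _ _ _

theorem evalTruncation_zero (m : ℕ) : evalTruncation m (0 : List X → ℤ) = 0 := by
  have h := evalTruncation_add m (0 : List X → ℤ) 0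
  rwa [add_zero, left_eq_add] at h

/-- The difference is the homogeneous part of degree `m`, a combination of products of `m` factors
`x - 1`. -/
theorem evalTruncation_succ_sub_mem (m : ℕ) (f : List X → ℤ) :
    evalTruncation (m + 1) f - evalTruncation m f ∈ weightedIdeal (fun _ : X => 1) m := by
  induction m generalizing f with
  | zero => simp [weightedIdeal_zero]
  | succ m ih =>
    rw [evalTruncation, evalTruncation, add_sub_add_left_eq_sub, ← Finset.sum_sub_distrib]
    refine sum_mem fun x _ => ?_
    rw [← mul_sub]
    exact sub_one_mul_mem x (ih _)

theorem evalTruncation_eq_one {m : ℕ} (hm : 1 ≤ m) {f : List X → ℤ} (h0 : f [] = 1)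
    (h : ∀ v, v ≠ [] → v.length < m → f v = 0) : evalTruncation m f = 1 := by
  have hz : ∀ (k : ℕ) (f : List X → ℤ), (∀ v, v.length < k → f v = 0) →
      evalTruncation k f = 0 := by
    intro k
    induction k with
    | zero => intro f _; rfl
    | succ k ih =>
      intro f hf
      rw [evalTruncation, hf [] (by simp), Finset.sum_eq_zero]
      · simp
      · intro x _
        rw [ih _ fun v hv => hf _ (by simpa using hv), mul_zero]
  obtain ⟨k, rfl⟩ := Nat.exists_eq_add_of_le' hm
  rw [evalTruncation, h0, Finset.sum_eq_zero]
  · simp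
  · intro x _
    rw [hz k _ fun v hv => h _ (by simp) (by simpa using hv), mul_zero]

end Truncation

variable [DecidableEq X]

/-- Multiplication by `1 + x` on noncommutative power series. -/
def mulLetter (x : X) : (List X → ℤ) →ₗ[ℤ] (List X → ℤ) where
  toFun f
    | [] => f []
    | y :: v => f (y :: v) + if y = x then f v else 0
  map_add' f g := by
    funext v
    cases v with
    | nil => rfl
    | cons y v => simp only [Pi.add_apply]; split_ifs <;> ring
  map_smul' r f := by
    funext v
    cases v with
    | nil => rfl
    | cons y v => simp [mul_add]

/-- The coefficients of the product of a power series by `(1 + x)⁻¹`. -/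
def mulLetterInvFun (x : X) (f : List X → ℤ) : List X → ℤ
  | [] => f []
  | y :: v => f (y :: v) - if y = x then mulLetterInvFun x f v else 0

/-- Multiplication by `1 + x` on noncommutative power series, as an automorphism. -/
def mulLetterEquiv (x : X) : (List X → ℤ) ≃ₗ[ℤ] (List X → ℤ) where
  __ := mulLetter x
  invFun := mulLetterInvFun x
  left_inv f := by
    funext v
    induction v with
    | nil => rfl
    | cons y v ih =>
      rw [mulLetterInvFun, ih]
      simp [mulLetter]
  right_inv f := by
    funext v
    cases v with
    | nil => rfl
    | cons y v => simp [mulLetter, mulLetterInvFun]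

theorem mulLetterEquiv_nil (x : X) (f : List X → ℤ) : mulLetterEquiv x f [] = f [] := rfl

theorem mulLetterEquiv_cons (x : X) (f : List X → ℤ) (y : X) (v : List X) :
    mulLetterEquiv x f (y :: v) = f (y :: v) + if y = x then f v else 0 := rfl

/-- The Magnus representation on noncommutative power series. -/
def magnusRep : FreeGroup X →* (List X → ℤ) ≃ₗ[ℤ] (List X → ℤ) :=
  FreeGroup.lift mulLetterEquiv

theorem magnusRep_of (x : X) : magnusRep (FreeGroup.of x) = mulLetterEquiv x :=
  FreeGroup.lift_apply_of

/-- The Magnus coefficients of an element of a free group. -/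
def magnusCoeff (g : FreeGroup X) : List X → ℤ := magnusRep g oneSeries

theorem mulLetterEquiv_mem {x : X} {j : ℕ} {f : List X → ℤ} (hf : f ∈ seriesFiltration X j) :
    mulLetterEquiv x f - f ∈ seriesFiltration X (j + 1) := by
  intro v hv
  cases v with
  | nil => simp [mulLetterEquiv_nil]
  | cons y v =>
    rw [Pi.sub_apply, mulLetterEquiv_cons, add_sub_cancel_left]
    split_ifs
    · exact hf v (by simpa using hv)
    · rfl

theorem mulLetterEquiv_symm_mem {x : X} {j : ℕ} {f : List X → ℤ}
    (hf : f ∈ seriesFiltration X j) : (mulLetterEquiv x).symm f ∈ seriesFiltration X j := by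
  intro v hv
  change mulLetterInvFun x f v = 0
  induction v with
  | nil => exact hf _ hv
  | cons y v ih =>
    rw [mulLetterInvFun, hf _ hv, ih (by simp at hv; omega)]
    simp

/-- The Magnus representation, as a homomorphism to the ring of endomorphisms. -/
def magnusHom : FreeGroup X →* Module.End ℤ (List X → ℤ) where
  toFun g := (magnusRep g).toLinearMap
  map_one' := by rw [map_one]; rfl
  map_mul' a b := by rw [map_mul]; rfl

theorem magnusHom_mem (g : FreeGroup X) :
    magnusHom g ∈ endFiltration (seriesFiltration X) 0 := by
  have hE := isRingFiltration_endFiltration (seriesFiltration_antitone (X := X))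
  let A : Submonoid (Module.End ℤ (List X → ℤ)) :=
    { carrier := endFiltration (seriesFiltration X) 0
      one_mem' := hE.one_mem
      mul_mem' := fun {a b} ha hb => by
        have h := hE.mul_mem (i := 0) (j := 0) ha hb
        rwa [zero_add] at h }
  refine freeGroup_mem_submonoid magnusHom A (fun z i f hf => ?_) (fun z i f hf => ?_) g
  · change magnusRep (FreeGroup.of z) f ∈ _
    rw [magnusRep_of]
    have h := add_mem (seriesFiltration_antitone (Nat.le_add_right i 1)
      (mulLetterEquiv_mem (x := z) hf)) hf
    rw [sub_add_cancel] at h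
    exact h
  · change magnusRep (FreeGroup.of z)⁻¹ f ∈ _
    rw [map_inv, magnusRep_of]
    exact mulLetterEquiv_symm_mem hf

/-- Each generator acts as the identity up to degree `1`, and the congruence subgroups of the
representation form an N-series. -/
theorem magnusRep_sub_mem {j : ℕ} (hj : 1 ≤ j) {g : FreeGroup X}
    (hg : g ∈ lcs (⊤ : Subgroup (FreeGroup X)) j) {i : ℕ} {f : List X → ℤ}
    (hf : f ∈ seriesFiltration X i) : magnusRep g f - f ∈ seriesFiltration X (i + j) := by
  have hE := isRingFiltration_endFiltration (seriesFiltration_antitone (X := X))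
  have hS := isNSeries_congruenceSubgroup hE magnusHom magnusHom_mem
  refine hS.lcs_le ?_ hj hg i f hf
  rw [← FreeGroup.closure_range_of, Subgroup.closure_le]
  rintro _ ⟨x, rfl⟩ i f hf
  change magnusRep (FreeGroup.of x) f - f ∈ _
  rw [magnusRep_of]
  exact mulLetterEquiv_mem hf

theorem magnusCoeff_mul_of_mem_lcs {j : ℕ} (hj : 1 ≤ j) {g : FreeGroup X}
    (hg : g ∈ lcs (⊤ : Subgroup (FreeGroup X)) j) (h : FreeGroup X) {v : List X}
    (hv : v.length < j) : magnusCoeff (g * h) v = magnusCoeff h v := by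
  have h1 := magnusRep_sub_mem hj hg (i := 0) (f := magnusCoeff h) (fun v hv => by omega) v
    (by omega)
  rw [Pi.sub_apply, sub_eq_zero] at h1
  rw [← h1, magnusCoeff, magnusCoeff, map_mul]
  rfl

/-- Right multiplication by `1 + x` on noncommutative power series. -/
def mulLetterRight (x : X) (f : List X → ℤ) (v : List X) : ℤ :=
  f v + if v.getLast? = some x then f v.dropLast else 0

theorem mulLetterRight_mulLetterEquiv (x y : X) (f : List X → ℤ) :
    mulLetterRight x (mulLetterEquiv y f) = mulLetterEquiv y (mulLetterRight x f) := by
  funext v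
  match v with
  | [] => simp [mulLetterRight, mulLetterEquiv_nil]
  | [z] =>
    simp only [mulLetterRight, mulLetterEquiv_cons, List.getLast?_singleton, List.dropLast_singleton,
      mulLetterEquiv_nil, List.getLast?_nil, Option.some.injEq]
    split_ifs <;> simp_all
  | z :: a :: v =>
    simp only [mulLetterRight, mulLetterEquiv_cons, List.getLast?_cons_cons,
      List.dropLast_cons_cons]
    split_ifs <;> ring

/-- Left and right multiplications commute. This gives access to the coefficients of `g x`, although
the representation is built from left multiplications. -/
theorem magnusRep_mulLetterRight (x : X) (g : FreeGroup X) (f : List X → ℤ) :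
    magnusRep g (mulLetterRight x f) = mulLetterRight x (magnusRep g f) := by
  induction g using FreeGroup.induction_on generalizing f with
  | C1 => simp
  | of z => rw [magnusRep_of, mulLetterRight_mulLetterEquiv]
  | inv_of z ih =>
    have h := ih (magnusRep (FreeGroup.of z)⁻¹ f)
    have e : ∀ f, magnusRep (FreeGroup.of z) (magnusRep (FreeGroup.of z)⁻¹ f) = f := fun f => by
      rw [← LinearEquiv.mul_apply, ← map_mul]; simp
    rw [e] at h
    apply (magnusRep (FreeGroup.of z)).injective
    rw [e, h]
  | mul a b ha hb => rw [map_mul, LinearEquiv.mul_apply, LinearEquiv.mul_apply, hb, ha]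

theorem magnusCoeff_mul_of (g : FreeGroup X) (x : X) (v : List X) :
    magnusCoeff (g * FreeGroup.of x) v =
      magnusCoeff g v + if v.getLast? = some x then magnusCoeff g v.dropLast else 0 := by
  have h : mulLetterEquiv x oneSeries = mulLetterRight x oneSeries := by
    funext v
    match v with
    | [] => simp [mulLetterRight, mulLetterEquiv_nil]
    | [z] => simp [mulLetterRight, mulLetterEquiv_cons]
    | z :: a :: v => simp [mulLetterRight, mulLetterEquiv_cons, oneSeries]
  rw [magnusCoeff, map_mul, LinearEquiv.mul_apply, magnusRep_of, h, magnusRep_mulLetterRight]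
  rfl

theorem magnusCoeff_of_mul_cons (g : FreeGroup X) (x y : X) (v : List X) :
    magnusCoeff (FreeGroup.of x * g) (y :: v) =
      magnusCoeff g (y :: v) + if y = x then magnusCoeff g v else 0 := by
  rw [magnusCoeff, map_mul, LinearEquiv.mul_apply, magnusRep_of, mulLetterEquiv_cons]
  rfl

theorem magnusCoeff_nil (g : FreeGroup X) : magnusCoeff g [] = 1 := by
  have h := magnusCoeff_mul_of_mem_lcs le_rfl (g := g) (by rw [lcs_one]; trivial) 1
    (v := []) (by simp)
  rw [mul_one] at h
  rw [h]
  simp [magnusCoeff, oneSeries]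

section Truncation

variable [Fintype X]

/-- The only error comes from the term `(x - 1) f`, where truncating the product at `m + 1`
truncates `f` at `m`. -/
theorem evalTruncation_mulLetterEquiv (m : ℕ) (x : X) (f : List X → ℤ) :
    evalTruncation m (mulLetterEquiv x f) - toRing (FreeGroup.of x) * evalTruncation m f ∈
      weightedIdeal (fun _ : X => 1) m := by
  cases m with
  | zero => simp [weightedIdeal_zero]
  | succ m =>
    have e : ∀ y, (fun v => mulLetterEquiv x f (y :: v)) =
        (fun v => f (y :: v)) + if y = x then f else 0 := fun y => by
      funext v
      rw [mulLetterEquiv_cons, Pi.add_apply]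
      split_ifs <;> rfl
    have h1 : evalTruncation (m + 1) (mulLetterEquiv x f) =
        evalTruncation (m + 1) f + (toRing (FreeGroup.of x) - 1) * evalTruncation m f := by
      rw [evalTruncation, evalTruncation, mulLetterEquiv_nil, add_assoc, add_right_inj]
      simp only [e, evalTruncation_add, mul_add, Finset.sum_add_distrib, add_right_inj]
      rw [Finset.sum_eq_single x]
      · simp
      · intro y _ hy
        simp [hy, evalTruncation_zero]
      · simp
    have h2 := neg_mem (sub_one_mul_mem x (evalTruncation_succ_sub_mem m f))
    convert h2 using 1
    rw [h1]
    noncomm_ring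

theorem evalTruncation_magnusRep (m : ℕ) (g : FreeGroup X) (f : List X → ℤ) :
    evalTruncation m (magnusRep g f) - toRing g * evalTruncation m f ∈
      weightedIdeal (fun _ : X => 1) m := by
  induction g using FreeGroup.induction_on generalizing f with
  | C1 =>
    rw [map_one, map_one, one_mul, LinearEquiv.coe_one, id, sub_self]
    exact zero_mem _
  | of z =>
    rw [magnusRep_of]
    exact evalTruncation_mulLetterEquiv m z f
  | inv_of z ih =>
    have h := ih (magnusRep (FreeGroup.of z)⁻¹ f)
    rw [← LinearEquiv.mul_apply, ← map_mul, mul_inv_cancel, map_one, LinearEquiv.coe_one, id]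
      at h
    have h2 := mul_mem_weightedIdeal_right (a := toRing (FreeGroup.of z)⁻¹) (neg_mem h)
    convert h2 using 1
    have e : toRing (FreeGroup.of z)⁻¹ * toRing (FreeGroup.of z) = 1 := by
      rw [← map_mul, inv_mul_cancel, map_one]
    rw [neg_sub, mul_sub, ← mul_assoc, e, one_mul]
  | mul a b ha hb =>
    have h1 := add_mem (ha (magnusRep b f))
      (mul_mem_weightedIdeal_right (a := toRing a) (hb f))
    convert h1 using 1
    rw [map_mul, map_mul, LinearEquiv.mul_apply, mul_sub, mul_assoc, sub_add_sub_cancel]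

/-- Magnus' theorem: an element of a free group whose Magnus expansion has no term of positive
degree less than `m` is in the `m`-th term of the lower central series. -/
theorem mem_lcs_of_magnusCoeff_eq_zero {m : ℕ} (hm : 1 ≤ m) {g : FreeGroup X}
    (h : ∀ v, v ≠ [] → v.length < m → magnusCoeff g v = 0) :
    g ∈ lcs (⊤ : Subgroup (FreeGroup X)) m := by
  -- Below degree `m` both the expansion of `g` and the series `1` evaluate to `1`, so `g ≡ 1`
  -- modulo the `m`-th power of the augmentation ideal.
  have h1 := evalTruncation_magnusRep m g oneSeries
  rw [evalTruncation_eq_one hm (f := magnusRep g oneSeries) (magnusCoeff_nil g) h,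
    evalTruncation_eq_one hm (by simp [oneSeries]) (fun v hv _ => oneSeries_of_ne_nil hv),
    mul_one] at h1
  have h2 := neg_mem h1
  rw [neg_sub] at h2
  have h3 := mem_weightedLCS_of_sub_one_mem (fun _ : X => 1) (fun _ => le_rfl) (Set.toFinite _) h2
  exact weightedLCS_le _ isNSeries_lcs_top (fun x => by rw [lcs_one]; trivial) m h3

end Truncation

end Magnus

/-! ### Centralizer of a generator modulo the lower central series -/

section Centralizer

variable {X : Type u} [DecidableEq X]

/-- Compare the coefficients of `g x` and `x g` at the word `x u y`, of length at most `j`: the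
common term, the coefficient of `g` at `x u y`, cancels. -/
theorem magnusCoeff_append_of_commutator_mem {x : X} {g : FreeGroup X} {j : ℕ}
    (h : g * FreeGroup.of x * g⁻¹ * (FreeGroup.of x)⁻¹ ∈ lcs (⊤ : Subgroup (FreeGroup X)) (j + 1))
    (u : List X) (y : X) (hu : (u ++ [y]).length < j) :
    magnusCoeff g (u ++ [y]) = if y = x then magnusCoeff g (x :: u) else 0 := by
  have h1 := magnusCoeff_mul_of_mem_lcs (by omega) h (FreeGroup.of x * g)
    (v := x :: (u ++ [y])) (by simpa using hu)
  have e : g * FreeGroup.of x * g⁻¹ * (FreeGroup.of x)⁻¹ * (FreeGroup.of x * g) =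
      g * FreeGroup.of x := by group
  rw [e, magnusCoeff_mul_of, magnusCoeff_of_mul_cons, if_pos rfl, add_right_inj,
    ← List.cons_append, List.getLast?_concat, List.dropLast_concat] at h1
  rw [← h1]
  simp

theorem exists_eq_append_cons_replicate (x : X) {v : List X} (h : ∃ y ∈ v, y ≠ x) :
    ∃ (u : List X) (y : X) (k : ℕ), y ≠ x ∧ v = u ++ y :: List.replicate k x := by
  induction v using List.reverseRecOn with
  | nil => simp at h
  | append_singleton v z ih =>
    by_cases hz : z = x
    · subst hz
      obtain ⟨y, hy, hyz⟩ := h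
      obtain ⟨u, y, k, hne, rfl⟩ := ih ⟨y, by simpa [hyz] using hy, hyz⟩
      exact ⟨u, y, k + 1, hne, by simp [List.replicate_succ']⟩
    · exact ⟨v, z, 0, hz, by simp⟩

/-- The previous relation moves a final `x` to the front without changing the coefficient. After all
trailing `x` are rotated, the last letter differs from `x` and the coefficient vanishes. -/
theorem magnusCoeff_eq_zero_of_commutator_mem {x : X} {g : FreeGroup X} {j : ℕ}
    (h : g * FreeGroup.of x * g⁻¹ * (FreeGroup.of x)⁻¹ ∈ lcs (⊤ : Subgroup (FreeGroup X)) (j + 1))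
    {v : List X} (hv : v.length < j) (hx : ∃ y ∈ v, y ≠ x) : magnusCoeff g v = 0 := by
  obtain ⟨u, y, k, hne, rfl⟩ := exists_eq_append_cons_replicate x hx
  clear hx
  induction k generalizing u with
  | zero =>
    rw [List.replicate_zero] at hv ⊢
    rw [magnusCoeff_append_of_commutator_mem h u y hv, if_neg hne]
  | succ k ih =>
    have e : u ++ y :: List.replicate (k + 1) x = (u ++ y :: List.replicate k x) ++ [x] := by
      simp [List.replicate_succ']
    rw [e] at hv ⊢
    rw [magnusCoeff_append_of_commutator_mem h _ x hv, if_pos rfl, ← List.cons_append]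
    refine ih _ ?_
    simp only [List.length_append, List.length_cons, List.length_nil, List.length_replicate] at hv ⊢
    omega

/-- Restricting series to the powers of `x` amounts to setting the other letters to zero, so only
the image of `g` in `⟨x⟩` matters. -/
theorem magnusRep_replicate (x : X) (g : FreeGroup X) {f f' : List X → ℤ}
    (hf : ∀ k, f (List.replicate k x) = f' (List.replicate k x)) (k : ℕ) :
    magnusRep g f (List.replicate k x) =
      magnusRep (FreeGroup.of x ^ (exponent x g).toAdd) f' (List.replicate k x) := by
  have hpos : ∀ {f f' : List X → ℤ}, (∀ k, f (List.replicate k x) = f' (List.replicate k x)) →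
      ∀ k, mulLetterEquiv x f (List.replicate k x) = mulLetterEquiv x f' (List.replicate k x) := by
    intro f f' hf k
    cases k with
    | zero => exact hf 0
    | succ k =>
      rw [List.replicate_succ, mulLetterEquiv_cons, mulLetterEquiv_cons, hf k,
        ← List.replicate_succ, hf (k + 1)]
  have hne : ∀ {z}, z ≠ x → ∀ (f : List X → ℤ) (k),
      mulLetterEquiv z f (List.replicate k x) = f (List.replicate k x) := by
    intro z hz f k
    cases k with
    | zero => rfl
    | succ k => rw [List.replicate_succ, mulLetterEquiv_cons, if_neg hz.symm, add_zero]
  induction g using FreeGroup.induction_on generalizing f f' k with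
  | C1 => simpa using hf k
  | of z =>
    by_cases hz : z = x
    · subst hz
      simpa [exponent, magnusRep_of] using hpos hf k
    · simpa [exponent, hz, magnusRep_of, hne hz] using hf k
  | inv_of z _ =>
    by_cases hz : z = x
    · subst hz
      have e : (exponent z (FreeGroup.of z)⁻¹).toAdd = -1 := by simp [exponent]
      rw [e, zpow_neg_one, map_inv, magnusRep_of]
      change mulLetterInvFun z f _ = mulLetterInvFun z f' _
      induction k with
      | zero => exact hf 0
      | succ k ih =>
        rw [List.replicate_succ, mulLetterInvFun, mulLetterInvFun, ih, ← List.replicate_succ,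
          hf (k + 1)]
    · have e : (exponent x (FreeGroup.of z)⁻¹).toAdd = 0 := by simp [exponent, hz]
      have h := hne hz (magnusRep (FreeGroup.of z)⁻¹ f) k
      rw [← magnusRep_of, ← LinearEquiv.mul_apply, ← map_mul, mul_inv_cancel, map_one] at h
      rw [e, zpow_zero, map_one, ← h]
      exact hf k
  | mul a b ha hb =>
    rw [map_mul, map_mul, toAdd_mul, zpow_add, map_mul, LinearEquiv.mul_apply,
      LinearEquiv.mul_apply]
    exact ha (hb hf) k

/-- The centralizer of a generator modulo a term of the lower central series. -/
theorem mul_zpow_inv_mem_lcs [Fintype X] {x : X} {g : FreeGroup X} {j : ℕ} (hj : 1 ≤ j)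
    (h : g * FreeGroup.of x * g⁻¹ * (FreeGroup.of x)⁻¹ ∈
      lcs (⊤ : Subgroup (FreeGroup X)) (j + 1)) :
    g * (FreeGroup.of x ^ (exponent x g).toAdd)⁻¹ ∈ lcs (⊤ : Subgroup (FreeGroup X)) j := by
  set e := (exponent x g).toAdd with he
  refine mem_lcs_of_magnusCoeff_eq_zero hj fun v hv hvj => ?_
  -- Replacing `g` by `g x⁻ᵉ` does not change its commutator with `x`, so mixed words have
  -- coefficient zero; on powers of `x`, the vanishing exponent sum leaves the series `1`.
  by_cases hx : ∃ y ∈ v, y ≠ x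
  · refine magnusCoeff_eq_zero_of_commutator_mem (j := j) (x := x) ?_ hvj hx
    convert h using 1
    group
  · have hrep : v = List.replicate v.length x :=
      List.eq_replicate_iff.2 ⟨rfl, fun y hy => by_contra fun hne => hx ⟨y, hy, hne⟩⟩
    have hexp : (exponent x (g * (FreeGroup.of x ^ e)⁻¹)).toAdd = 0 := by
      have : exponent x (FreeGroup.of x) = Multiplicative.ofAdd 1 := by simp [exponent]
      rw [map_mul, map_inv, map_zpow, this, toAdd_mul, toAdd_inv, toAdd_zpow, ← he]
      simp
    rw [hrep, magnusCoeff, magnusRep_replicate x _ (fun _ => rfl), hexp, zpow_zero, map_one,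
      ← hrep]
    exact oneSeries_of_ne_nil hv

end Centralizer

/-! ### Generalities on the Andreadakis filtration -/

section Andreadakis

variable {G : Type*} [Group G]

/-- Modulo `Γ_{i+2}`, let `φ(a) = a' a` with `a ∈ Γ_i`, and `φ(g) = g' g`. By induction `a'` is in
`Γ_{i+1}`, hence central, and `g' ∈ Γ_2` commutes with `a` and with `[a, g]`. So `φ` fixes `[a, g]`,
and such commutators generate `Γ_{i+1}`. -/
theorem IA_le_andreadakisFiltration_one : IA G ≤ andreadakisFiltration G 1 := by
  intro φ hφ i hi
  induction i, hi using Nat.le_induction with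
  | base =>
    intro h _
    have h1 : φ h / h ∈ commutator G := QuotientGroup.eq_iff_div_mem.1 (hφ h)
    rwa [div_eq_mul_inv] at h1
  | succ i hi ih =>
    let N := lcs (⊤ : Subgroup G) (i + 1 + 1)
    have key : lcs (⊤ : Subgroup G) (i + 1) ≤
        MonoidHom.eqLocus ((QuotientGroup.mk' N).comp φ.toMonoidHom) (QuotientGroup.mk' N) := by
      rw [lcs_succ _ i hi, Subgroup.commutator_le]
      intro a ha g _
      have hcen : ∀ z ∈ lcs (⊤ : Subgroup G) (i + 1), ∀ y : G,
          Commute (QuotientGroup.mk' N z) (QuotientGroup.mk' N y) := fun z hz y => by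
        rw [← commutatorElement_eq_one_iff_commute, ← map_commutatorElement,
          QuotientGroup.mk'_apply, QuotientGroup.eq_one_iff]
        exact Subgroup.commutator_mem_commutator hz (Subgroup.mem_top y)
      have ha' := ih a ha
      have hg' : φ g * g⁻¹ ∈ lcs (⊤ : Subgroup G) 2 := by
        have h1 : φ g / g ∈ commutator G := QuotientGroup.eq_iff_div_mem.1 (hφ g)
        rwa [div_eq_mul_inv] at h1
      have hga : Commute (QuotientGroup.mk' N (φ g * g⁻¹)) (QuotientGroup.mk' N a) := by
        rw [← commutatorElement_eq_one_iff_commute, ← map_commutatorElement,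
          QuotientGroup.mk'_apply, QuotientGroup.eq_one_iff, ← inv_mem_iff, commutatorElement_inv]
        exact commutator_lcs_top_le hi (by omega)
          (Subgroup.commutator_mem_commutator ha hg')
      have hag := hcen ⁅a, g⁆
        (commutator_lcs_top_le hi le_rfl (Subgroup.commutator_mem_commutator ha
          (Subgroup.mem_top g))) (φ g * g⁻¹)
      have hca := hcen _ ha'
      have e1 : φ a = φ a * a⁻¹ * a := by group
      have e2 : φ g = φ g * g⁻¹ * g := by group
      change QuotientGroup.mk' N (φ ⁅a, g⁆) = QuotientGroup.mk' N ⁅a, g⁆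
      rw [map_commutatorElement φ, e1, e2, map_commutatorElement, map_mul _ (φ a * a⁻¹),
        map_mul _ (φ g * g⁻¹)]
      rw [map_commutatorElement] at hag
      have h1 := hca (φ g * g⁻¹)
      have h2 := hca g
      have h3 := hca a
      rw [map_commutatorElement]
      generalize QuotientGroup.mk' N (φ a * a⁻¹) = a' at *
      generalize QuotientGroup.mk' N (φ g * g⁻¹) = g' at *
      generalize QuotientGroup.mk' N a = x at *
      generalize QuotientGroup.mk' N g = y at *
      have e3 : ⁅a' * x, g' * y⁆ = ⁅x, g' * y⁆ := by
        have h4 : Commute a' (x * (g' * y) * x⁻¹) :=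
          ((h3.mul_right (h1.mul_right h2)).mul_right h3.inv_right)
        rw [commutatorElement_def, commutatorElement_def, mul_inv_rev]
        calc a' * x * (g' * y) * (x⁻¹ * a'⁻¹) * (g' * y)⁻¹
            = a' * (x * (g' * y) * x⁻¹) * a'⁻¹ * (g' * y)⁻¹ := by group
          _ = x * (g' * y) * x⁻¹ * (g' * y)⁻¹ := by rw [h4.eq]; group
      have e4 : ⁅x, g' * y⁆ = g' * ⁅x, y⁆ * g'⁻¹ := by
        rw [commutatorElement_def, commutatorElement_def, ← mul_assoc x g' y, ← hga.eq]
        group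
      rw [e3, e4, ← hag.eq, mul_inv_cancel_right]
    intro h hh
    have h1 : φ h / h ∈ N := QuotientGroup.eq_iff_div_mem.1 (key hh)
    rwa [div_eq_mul_inv] at h1

theorem commutator_andreadakisFiltration_le (i j : ℕ) :
    ⁅andreadakisFiltration G i, andreadakisFiltration G j⁆ ≤ andreadakisFiltration G (i + j) := by
  rw [Subgroup.commutator_le]
  intro φ hφ ψ hψ k hk h' hh'
  -- Writing the argument as `ψ(φ(h))` turns `[φ, ψ]` into a comparison of `φψ(h)` with `ψφ(h)`.
  -- With `a = φ(h)h⁻¹` and `b = ψ(h)h⁻¹`, the quotient is `(φ(b)b⁻¹) [b, a] (ψ(a)a⁻¹)⁻¹`.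
  obtain ⟨h, rfl⟩ := (ψ * φ).surjective h'
  have hh : h ∈ lcs (⊤ : Subgroup G) k := by
    have := map_mem_lcs_top (ψ * φ)⁻¹ k hh'
    rwa [MulAut.inv_apply_self] at this
  have ha := hφ k hk h hh
  have hb := hψ k hk h hh
  have ha' := hψ _ (by omega) _ ha
  have hb' := hφ _ (by omega) _ hb
  have hab := commutator_lcs_top_le (by omega) (by omega)
    (Subgroup.commutator_mem_commutator hb ha)
  have e : ⁅φ, ψ⁆ ((ψ * φ) h) = φ (ψ h) := by
    rw [← MulAut.mul_apply, ← MulAut.mul_apply]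
    congr 1
    group
  have h1 := mul_mem (mul_mem (lcs_antitone _ (by omega) hb') (lcs_antitone _ (by omega) hab))
    (inv_mem (lcs_antitone _ (by omega) ha') : _ ∈ lcs (⊤ : Subgroup G) (k + (i + j)))
  rw [e]
  convert h1 using 1
  simp only [map_mul, map_inv, MulAut.mul_apply, commutatorElement_def]
  group

theorem lcs_le_andreadakisFiltration {j : ℕ} (hj : 1 ≤ j) :
    lcs (IA G) j ≤ andreadakisFiltration G j :=
  lcs_le_of_commutator_le IA_le_andreadakisFiltration_one
    (fun j _ => (Subgroup.commutator_mono le_rfl IA_le_andreadakisFiltration_one).trans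
      (commutator_andreadakisFiltration_le j 1)) hj

/-- The Andreadakis equality amounts to `K ∩ A_j ≤ Γ_j(K)`. -/
theorem satisfiesAndreadakisEquality_of_le {K : Subgroup (MulAut G)} (hK : K ≤ IA G)
    (h : ∀ j, 1 ≤ j → K ⊓ andreadakisFiltration G j ≤ lcs K j) :
    SatisfiesAndreadakisEquality K := by
  refine ⟨hK, fun j hj => ?_⟩
  have h1 : lcs K j ≤ K ⊓ lcs (IA G) j :=
    le_inf (K.lowerCentralSeries_le_self _) (lcs_mono hK j)
  have h2 : K ⊓ lcs (IA G) j ≤ K ⊓ andreadakisFiltration G j :=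
    inf_le_inf_left _ (lcs_le_andreadakisFiltration hj)
  exact ⟨le_antisymm h1 (h2.trans (h j hj)), le_antisymm h2 ((h j hj).trans h1)⟩

theorem map_mem_lcs {H : Type*} [Group H] (f : G →* H) {K : Subgroup G} {L : Subgroup H}
    (hKL : ∀ x ∈ K, f x ∈ L) {j : ℕ} {x : G} (hx : x ∈ lcs K j) : f x ∈ lcs L j := by
  have h : K.map f ≤ L := by
    rintro _ ⟨y, hy, rfl⟩
    exact hKL y hy
  refine lcs_mono h j ?_
  rw [← map_lcs]
  exact Subgroup.mem_map_of_mem f hx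

theorem inn_le_IA : inn G ≤ IA G := by
  rintro _ ⟨g, rfl⟩ h
  simp

instance inn_normal : (inn G).Normal where
  conj_mem := by
    rintro _ ⟨g, rfl⟩ φ
    refine ⟨φ g, ?_⟩
    ext h
    simp

theorem conj_mem_lcs_inn {j : ℕ} {g : G} (hg : g ∈ lcs (⊤ : Subgroup G) j) :
    MulAut.conj g ∈ lcs (inn G) j :=
  map_mem_lcs (L := inn G) MulAut.conj (fun x _ => MonoidHom.mem_range.2 ⟨x, rfl⟩) hg

end Andreadakis

/-! ### Triangular automorphisms and the main inclusion -/

section Triangular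

variable {n : ℕ} {F : Type*} [Group F] (b : FreeGroupBasis (Fin n) F)

theorem closure_range_basis {ι : Type*} (b : FreeGroupBasis ι F) :
    Subgroup.closure (Set.range b) = ⊤ := by
  have h := congrArg (Subgroup.map b.repr.symm.toMonoidHom) (FreeGroup.closure_range_of ι)
  rw [MonoidHom.map_closure, ← Set.range_comp] at h
  rw [← Subgroup.map_top_of_surjective b.repr.symm.toMonoidHom b.repr.symm.surjective, ← h]
  rfl

theorem lift_basis {ι H : Type*} [Group H] (b : FreeGroupBasis ι F) (f : ι → H) (i : ι) :
    b.lift f (b i) = f i := by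
  simp [FreeGroupBasis.lift]

theorem exists_mul_zpow_inv_mem_lcs {i : Fin n} {g : F} {j : ℕ} (hj : 1 ≤ j)
    (h : g * b i * g⁻¹ * (b i)⁻¹ ∈ lcs (⊤ : Subgroup F) (j + 1)) :
    ∃ e : ℤ, g * (b i ^ e)⁻¹ ∈ lcs (⊤ : Subgroup F) j := by
  have h1 := map_mem_lcs (L := ⊤) b.repr.toMonoidHom (fun _ _ => Subgroup.mem_top _) h
  have h2 := mul_zpow_inv_mem_lcs (x := i) (g := b.repr g) hj (by simpa using h1)
  refine ⟨(exponent i (b.repr g)).toAdd, ?_⟩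
  have h3 := map_mem_lcs (L := ⊤) b.repr.symm.toMonoidHom (fun _ _ => Subgroup.mem_top _) h2
  have e : b.repr.symm (FreeGroup.of i) = b i := rfl
  simpa [e] using h3

/-- The endomorphism fixing the elements of the basis of index `< k` and killing the others. -/
def truncationHom (k : ℕ) : F →* F := b.lift fun i => if (i : ℕ) < k then b i else 1

theorem truncationHom_of_mem {k : ℕ} {u : F} (hu : u ∈ initialSubgroup b k) :
    truncationHom b k u = u := by
  have h : initialSubgroup b k ≤ MonoidHom.eqLocus (truncationHom b k) (MonoidHom.id F) := by
    rw [initialSubgroup, Subgroup.closure_le]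
    rintro _ ⟨i, hi : (i : ℕ) < k, rfl⟩
    change truncationHom b k (b i) = b i
    rw [truncationHom, lift_basis, if_pos hi]
  exact h hu

theorem truncationHom_mem (k : ℕ) (u : F) : truncationHom b k u ∈ initialSubgroup b k := by
  have h : (⊤ : Subgroup F) ≤ (initialSubgroup b k).comap (truncationHom b k) := by
    rw [← closure_range_basis b, Subgroup.closure_le]
    rintro _ ⟨i, rfl⟩
    change truncationHom b k (b i) ∈ initialSubgroup b k
    rw [truncationHom, lift_basis]
    split_ifs with hi
    · exact basis_mem_initialSubgroup b i hi
    · exact one_mem _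
  exact h (Subgroup.mem_top u)

theorem truncationHom_mem_lcs {k j : ℕ} {u : F} (hu : u ∈ lcs (⊤ : Subgroup F) j) :
    truncationHom b k u ∈ lcs (initialSubgroup b k) j :=
  map_mem_lcs _ (fun x _ => truncationHom_mem b k x) hu

/-- The endomorphism `b k ↦ p⁻¹ * b k * q` fixing the other elements of the basis. -/
def transvection (k : Fin n) (p q : F) : F →* F :=
  b.lift (Function.update b k (p⁻¹ * b k * q))

theorem transvection_self (k : Fin n) (p q : F) :
    transvection b k p q (b k) = p⁻¹ * b k * q := by
  rw [transvection, lift_basis, Function.update_self]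

theorem transvection_of_ne {k i : Fin n} (h : i ≠ k) (p q : F) :
    transvection b k p q (b i) = b i := by
  rw [transvection, lift_basis, Function.update_of_ne h]

theorem transvection_of_mem (k : Fin n) (p q : F) {u : F} (hu : u ∈ initialSubgroup b k) :
    transvection b k p q u = u := by
  have h : initialSubgroup b k ≤
      MonoidHom.eqLocus (transvection b k p q) (MonoidHom.id F) := by
    rw [initialSubgroup, Subgroup.closure_le]
    rintro _ ⟨i, hi : (i : ℕ) < k, rfl⟩
    have hne : i ≠ k := by
      rintro rfl
      exact lt_irrefl _ hi
    exact transvection_of_ne b hne p q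
  exact h hu

/-- `p'` and `q'` involve only basis elements that the outer transvection fixes; the inverse on the
left factor makes the order of multiplication come out right. -/
theorem transvection_comp (k : Fin n) (p q : F) {p' q' : F} (hp : p' ∈ initialSubgroup b k)
    (hq : q' ∈ initialSubgroup b k) :
    (transvection b k p q).comp (transvection b k p' q') =
      transvection b k (p * p') (q * q') := by
  refine b.ext_hom _ _ fun i => ?_
  rw [MonoidHom.comp_apply]
  by_cases hi : i = k
  · subst hi
    rw [transvection_self, transvection_self, map_mul, map_mul, map_inv, transvection_self,
      transvection_of_mem b i p q hp, transvection_of_mem b i p q hq]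
    group
  · rw [transvection_of_ne b hi, transvection_of_ne b hi, transvection_of_ne b hi]

theorem transvection_one (k : Fin n) : transvection b k 1 1 = MonoidHom.id F := by
  refine b.ext_hom _ _ fun i => ?_
  by_cases hi : i = k
  · subst hi
    rw [transvection_self]
    simp
  · rw [transvection_of_ne b hi]
    rfl

/-- The action of pairs of elements of `⟨b i⟩_{i < k}` by transvections of `b k`. -/
def transvectionAut (k : Fin n) : initialSubgroup b k × initialSubgroup b k →* MulAut F where
  toFun p := MonoidHom.toMulEquiv (transvection b k p.1 p.2)
    (transvection b k (p⁻¹).1 (p⁻¹).2)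
    (by
      rw [transvection_comp b k _ _ p.1.2 p.2.2]
      simpa using transvection_one b k)
    (by
      rw [transvection_comp b k _ _ (p⁻¹).1.2 (p⁻¹).2.2]
      simpa using transvection_one b k)
  map_one' := by
    ext u
    exact DFunLike.congr_fun (transvection_one b k) u
  map_mul' p q := by
    ext u
    exact (DFunLike.congr_fun (transvection_comp b k p.1 p.2 q.1.2 q.2.2) u).symm

theorem transvectionAut_self (k : Fin n) (p q : initialSubgroup b k) :
    transvectionAut b k (p, q) (b k) = (p : F)⁻¹ * b k * q :=
  transvection_self b k p q

theorem transvectionAut_of_ne {k i : Fin n} (h : i ≠ k) (p q : initialSubgroup b k) :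
    transvectionAut b k (p, q) (b i) = b i :=
  transvection_of_ne b h p q

theorem coe_mem_lcs_iff {K : Subgroup F} {j : ℕ} {u : K} :
    (u : F) ∈ lcs K j ↔ u ∈ lcs (⊤ : Subgroup K) j := by
  rw [lcs, ← Subgroup.top_subtype_lowerCentralSeries]
  exact Subgroup.mem_map_iff_mem K.subtype_injective

theorem transvectionAut_mem (k : Fin n) (w γ : initialSubgroup b k)
    (hγ : γ ∈ lcs (⊤ : Subgroup (initialSubgroup b k)) 2) :
    transvectionAut b k (w, w * γ) ∈ triangularSubgroup b := by
  intro i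
  by_cases hi : i = k
  · subst hi
    refine ⟨w, w.2, γ, coe_mem_lcs_iff.2 hγ, ?_⟩
    rw [transvectionAut_self, Subgroup.coe_mul, ← mul_assoc]
  · refine ⟨1, one_mem _, 1, one_mem _, ?_⟩
    rw [transvectionAut_of_ne b hi]
    simp

theorem transvectionAut_conj_mem_lcs (k : Fin n) {j : ℕ} {w : initialSubgroup b k}
    (hw : w ∈ lcs (⊤ : Subgroup (initialSubgroup b k)) j) :
    transvectionAut b k (w, w) ∈ lcs (triangularSubgroup b) j :=
  map_mem_lcs ((transvectionAut b k).comp ((MonoidHom.id _).prod (MonoidHom.id _)))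
    (fun w _ => by simpa using transvectionAut_mem b k w 1 (one_mem _)) hw

/-- The index shift starts at `Γ_2`, where the transvection is triangular by definition, and
propagates by `[(1, δ), (u, u)] = (1, [δ, u])`. -/
theorem transvectionAut_right_mem_lcs (k : Fin n) {j : ℕ} (hj : 1 ≤ j) {γ : initialSubgroup b k}
    (hγ : γ ∈ lcs (⊤ : Subgroup (initialSubgroup b k)) (j + 1)) :
    transvectionAut b k (1, γ) ∈ lcs (triangularSubgroup b) j := by
  induction j, hj using Nat.le_induction generalizing γ with
  | base => simpa [lcs_one] using transvectionAut_mem b k 1 γ hγ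
  | succ j hj ih =>
    suffices H : lcs (⊤ : Subgroup (initialSubgroup b k)) (j + 1 + 1) ≤
        (lcs (triangularSubgroup b) (j + 1)).comap
          ((transvectionAut b k).comp (MonoidHom.inr _ _)) from H hγ
    rw [lcs_succ ⊤ (j + 1) (by omega), Subgroup.commutator_le]
    intro δ hδ u _
    have h1 := transvectionAut_conj_mem_lcs b k (j := 1) (w := u) (Subgroup.mem_top u)
    have h2 := Subgroup.commutator_mem_commutator (ih hδ) h1
    rw [← map_commutatorElement] at h2
    have e : ⁅((1 : initialSubgroup b k), δ), (u, u)⁆ = (1, ⁅δ, u⁆) := by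
      simp [commutatorElement_def]
    rw [e] at h2
    rw [lcs_succ _ j hj]
    exact h2

theorem triangularSubgroup_le_IA : triangularSubgroup b ≤ IA F := by
  intro φ hφ
  have h : (Abelianization.of.comp φ.toMonoidHom : F →* Abelianization F) =
      Abelianization.of := by
    refine b.ext_hom _ _ fun i => ?_
    obtain ⟨w, _, γ, hγ, h⟩ := hφ i
    have hγ' : Abelianization.of γ = 1 := by
      have h1 : γ ∈ commutator F := Subgroup.commutator_mono le_top le_top hγ
      rwa [← Abelianization.ker_of] at h1
    change Abelianization.of (φ (b i)) = _
    rw [h, map_mul, map_mul, map_mul, hγ', map_inv, mul_one, mul_comm, mul_inv_cancel_left]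
  exact fun g => DFunLike.congr_fun h g

/-- A triangular automorphism in the `j`-th term of the Andreadakis filtration agrees on a given
element of the basis with some transvection in the `j`-th term of the lower central series. -/
theorem exists_transvection_mem_lcs {j : ℕ} (hj : 1 ≤ j) {φ : MulAut F}
    (hφ : φ ∈ triangularSubgroup b) (hφj : φ ∈ andreadakisFiltration F j) (k : Fin n) :
    ∃ g ∈ lcs (triangularSubgroup b) j, g (b k) = φ (b k) ∧ ∀ i ≠ k, g (b i) = b i := by
  obtain ⟨w, hw, γ, hγ, h⟩ := hφ k
  have hγF : γ ∈ initialSubgroup b k := Subgroup.commutator_le_self _ hγ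
  have h1 := hφj 1 le_rfl (b k) (Subgroup.mem_top _)
  rw [h, add_comm] at h1
  have hk : truncationHom b k (b k) = 1 := by
    rw [truncationHom, lift_basis, if_neg (lt_irrefl _)]
  -- Killing `b k` in `(w⁻¹ (b k) w) γ (b k)⁻¹` leaves `γ`.
  have hγj : γ ∈ lcs (initialSubgroup b k) (j + 1) := by
    have h2 := truncationHom_mem_lcs b (k := k) h1
    simpa [hk, truncationHom_of_mem b hw, truncationHom_of_mem b hγF] using h2
  -- Removing `γ`, conjugated by `b k`, leaves the commutator of `w⁻¹` and `b k`.
  have h3 := mul_mem h1 ((lcs_top_normal (G := F) (j + 1)).conj_mem _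
    (inv_mem (lcs_mono (le_top : initialSubgroup b k ≤ ⊤) _ hγj)) (b k))
  obtain ⟨e, he⟩ := exists_mul_zpow_inv_mem_lcs b (i := k) (g := w⁻¹) hj (by
    convert h3 using 1
    group)
  -- The retraction kills the unknown power of `b k`, leaving `w⁻¹` alone.
  have hwj : w ∈ lcs (initialSubgroup b k) j := by
    have h4 := truncationHom_mem_lcs b (k := k) he
    rw [map_mul, map_inv, map_inv, map_zpow, hk, truncationHom_of_mem b hw] at h4
    simpa using h4
  refine ⟨transvectionAut b k (⟨w, hw⟩, ⟨w, hw⟩) * transvectionAut b k (1, ⟨γ, hγF⟩),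
    mul_mem (transvectionAut_conj_mem_lcs b k (coe_mem_lcs_iff.1 hwj))
      (transvectionAut_right_mem_lcs b k hj (coe_mem_lcs_iff.1 hγj)), ?_, fun i hi => ?_⟩
  · rw [← map_mul, Prod.mk_mul_mk, transvectionAut_self, h]
    simp [mul_assoc]
  · rw [← map_mul, Prod.mk_mul_mk, transvectionAut_of_ne b hi]

/-- If `φ` fixes the basis elements of index less than `k`, dividing by the transvection that agrees
with it on `b k` gives an automorphism fixing one more, still in `A_j` because that transvection is
in `Γ_j(IA_n⁺)`. -/
theorem triangularSubgroup_inf_le_lcs {j : ℕ} (hj : 1 ≤ j) :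
    triangularSubgroup b ⊓ andreadakisFiltration F j ≤ lcs (triangularSubgroup b) j := by
  suffices H : ∀ d k : ℕ, n ≤ k + d →
      ∀ φ ∈ triangularSubgroup b, φ ∈ andreadakisFiltration F j →
        (∀ i : Fin n, (i : ℕ) < k → φ (b i) = b i) → φ ∈ lcs (triangularSubgroup b) j from
    fun φ hφ => H n 0 (by omega) φ hφ.1 hφ.2 fun i hi => absurd hi (Nat.not_lt_zero _)
  intro d
  induction d with
  | zero =>
    intro k hk φ _ _ hfix
    have h : φ = 1 := by
      ext u
      exact DFunLike.congr_fun (b.ext_hom φ.toMonoidHom (MonoidHom.id F)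
        fun i => hfix i (by omega)) u
    rw [h]
    exact one_mem _
  | succ d ih =>
    intro k hk φ hφ hφj hfix
    rcases Nat.lt_or_ge k n with hkn | hkn
    · obtain ⟨g, hg, hgk, hgi⟩ := exists_transvection_mem_lcs b hj hφ hφj ⟨k, hkn⟩
      have hgT : g ∈ triangularSubgroup b := Subgroup.lowerCentralSeries_le_self _ _ hg
      have hgj := lcs_le_andreadakisFiltration hj (lcs_mono (triangularSubgroup_le_IA b) j hg)
      have h1 := ih (k + 1) (by omega) (g⁻¹ * φ) (mul_mem (inv_mem hgT) hφ)
        (mul_mem (inv_mem hgj) hφj) fun i hi => by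
          rw [MulAut.mul_apply]
          rcases Nat.lt_succ_iff_lt_or_eq.1 hi with hlt | heq
          · have hne : i ≠ ⟨k, hkn⟩ := by
              rintro rfl
              exact lt_irrefl _ hlt
            rw [hfix i hlt]
            conv_lhs => rw [← hgi i hne]
            rw [MulAut.inv_apply_self]
          · have hik : i = ⟨k, hkn⟩ := Fin.ext heq
            rw [hik, ← hgk, MulAut.inv_apply_self]
      simpa using mul_mem hg h1
    · exact ih k (by omega) φ hφ hφj hfix

theorem triangular_apply_zero (hn : 0 < n) {φ : MulAut F} (hφ : φ ∈ triangularSubgroup b) :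
    φ (b ⟨0, hn⟩) = b ⟨0, hn⟩ := by
  obtain ⟨w, hw, γ, hγ, h⟩ := hφ ⟨0, hn⟩
  have hbot : initialSubgroup b 0 = ⊥ := by
    simp [initialSubgroup]
  have hγ' : γ ∈ initialSubgroup b 0 := Subgroup.commutator_le_self _ hγ
  have hw' : w ∈ initialSubgroup b 0 := hw
  rw [hbot, Subgroup.mem_bot] at hγ' hw'
  rw [h, hγ', hw']
  simp

theorem conj_zpow_basis_zero_mem (hn : 0 < n) (e : ℤ) :
    MulAut.conj (b ⟨0, hn⟩ ^ e) ∈ triangularSubgroup b := by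
  rw [map_zpow]
  refine zpow_mem (fun i => ?_) e
  rcases Nat.eq_zero_or_pos (i : ℕ) with hi | hi
  · have hi' : i = ⟨0, hn⟩ := Fin.ext hi
    exact ⟨1, one_mem _, 1, one_mem _, by simp [hi']⟩
  · exact ⟨(b ⟨0, hn⟩)⁻¹, inv_mem (basis_mem_initialSubgroup b ⟨0, hn⟩ hi), 1, one_mem _,
      by simp⟩

/-- In `c_g ψ`, the triangular factor fixes the first basis element, so `g` centralizes it modulo
`Γ_{j+1}` and is a power `z` of it modulo `Γ_j`. Then `c_g ψ = c_{g z⁻¹} (c_z ψ)`: the first factor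
is in `Γ_j(Inn F)`, and the second is triangular and in `A_j`. -/
theorem inn_sup_triangularSubgroup_inf_le_lcs {j : ℕ} (hj : 1 ≤ j) :
    (inn F ⊔ triangularSubgroup b) ⊓ andreadakisFiltration F j ≤
      lcs (inn F ⊔ triangularSubgroup b) j := by
  rintro φ ⟨hφ, hφj⟩
  rcases Nat.eq_zero_or_pos n with rfl | hn
  · have h : φ = 1 := by
      ext u
      exact DFunLike.congr_fun (b.ext_hom φ.toMonoidHom (MonoidHom.id F)
        fun i => i.elim0) u
    rw [h]
    exact one_mem _
  · obtain ⟨_, ⟨g, rfl⟩, ψ, hψ, rfl⟩ := Subgroup.mem_sup_of_normal_left.1 hφ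
    have h1 := hφj 1 le_rfl (b ⟨0, hn⟩) (Subgroup.mem_top _)
    rw [MulAut.mul_apply, triangular_apply_zero b hn hψ, MulAut.conj_apply, add_comm] at h1
    obtain ⟨e, he⟩ := exists_mul_zpow_inv_mem_lcs b hj h1
    set z := b ⟨0, hn⟩ ^ e with hz
    have h2 := conj_mem_lcs_inn he
    have h3 := lcs_le_andreadakisFiltration hj (lcs_mono inn_le_IA j h2)
    have e1 : MulAut.conj g * ψ = MulAut.conj (g * z⁻¹) * (MulAut.conj z * ψ) := by
      rw [← mul_assoc, ← map_mul, inv_mul_cancel_right]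
    rw [e1] at hφj ⊢
    have h4 := triangularSubgroup_inf_le_lcs b hj
      ⟨mul_mem (conj_zpow_basis_zero_mem b hn e) hψ, (Subgroup.mul_mem_cancel_left _ h3).1 hφj⟩
    exact mul_mem (lcs_mono le_sup_left j h2) (lcs_mono le_sup_right j h4)

end Triangular

end AndreadakisProblem

theorem mainTheorem9 (n : ℕ) {F : Type*} [Group F] (b : FreeGroupBasis (Fin n) F) :
    AndreadakisProblem.SatisfiesAndreadakisEquality
      (AndreadakisProblem.inn F ⊔ AndreadakisProblem.triangularSubgroup b) :=
  AndreadakisProblem.satisfiesAndreadakisEquality_of_le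
    (sup_le AndreadakisProblem.inn_le_IA (AndreadakisProblem.triangularSubgroup_le_IA b))
    fun _ hj => AndreadakisProblem.inn_sup_triangularSubgroup_inf_le_lcs b hj
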